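/- Let $\phi_0=dx_{123}+dx_{145}+dx_{167}+dx_{246}-dx_{257}-dx_{347}-dx_{356}$ on $\mathbb{R}^7$ and $$\Omega_0=dx_{1234}+dx_{1256}+dx_{1278}+dx_{1357}-dx_{1368}-dx_{1458}-dx_{1467}-dx_{2358}-dx_{2367}-dx_{2457}+dx_{2468}+dx_{3456}+dx_{3478}+dx_{5678}$$ on $\mathbb{R}^8$, where $dx_{i_1\cdots i_k}=dx_{i_1}\wedge\cdots\wedge dx_{i_k}$. A topological $G_2$-structure on a $7$-manifold $N$ is an orientation of $N$ together with a smooth $3$-form $\psi$ that is positive: for every $x\in N$ there is an orientation-preserving linear isomorphism $f\colon\mathbb{R}^7\to T_xN$ with $f^*\psi_x=\phi_0$. A topological $\mathrm{Spin}(7)$-structure on an $8$-manifold $M$ is an orientation of $M$ together with a smooth $4$-form $\Omega$ that is admissible: for every $p\in M$ there is an orientation-preserving linear isomorphism $f\colon\mathbb{R}^8\to T_pM$ with $f^*\Omega_p=\Omega_0$. In both cases the induced Riemannian metric is the one for which these isomorphisms $f$ are isometries (it is well defined because the stabilizers $G_2$ of $\phi_0$ and $\mathrm{Spin}(7)$ of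 $\Omega_0$ lie in $SO(7)$ and $SO(8)$). **Theorem.** Let $M_8$ be a smooth (Hausdorff, second countable) $8$-manifold with a smooth free action of $S^1$, let $v_p=\frac{d}{dt}\big|_{t=0}e^{it}\cdot p$ be its infinitesimal generator, and give $M_8/S^1$ the smooth structure for which the quotient map $\pi\colon M_8\to M_8/S^1$ is a smooth submersion. Suppose that $M_8/S^1$ is endowed with a topological $G_2$-structure, with positive $3$-form $\psi_3$. Then $M_8$ admits a topological $\mathrm{Spin}(7)$-structure, with admissible $4$-form $\Omega$ and induced metric $g$, such that 1. $\pi$ is a Riemannian submersion with respect to $g$ and the metric on $M_8/S^1$ induced by $\psi_3$; 2. $g(v,v)=1$ and $$\Omega=v^\flat\wedge\pi^*\psi_3+\ast\left(v^\flat\wedge\pi^*\psi_3\right),$$ where $v^\flat=g(v,\cdot)$ and $\ast$ is the Hodge star operator of $g$ and of the orientation of $M_8$; 3. $\Omega$ is $S^1$-invariant. -/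

import Mathlib

open scoped Manifold ContDiff Topology

noncomputable section

/-! ### Linear algebra: forms, orientations, wedge product, Hodge star -/

section LinearAlgebra

/-- The constant-coefficient form `dx_{i₁} ∧ ⋯ ∧ dx_{i_k}` on `ℝⁿ`, where `I = (i₁, …, i_k)`:
its value on `(v₁, …, v_k)` is `det (v_a (i_b))`. Indices start at `0`. -/
def dxForm {n k : ℕ} (I : Fin k → Fin n) : EuclideanSpace ℝ (Fin n) [⋀^Fin k]→ₗ[ℝ] ℝ :=
  (Matrix.detRowAlternating (n := Fin k) (R := ℝ)).compLinearMap
    (LinearMap.pi fun b => (EuclideanSpace.proj (I b) : EuclideanSpace ℝ (Fin n) →L[ℝ] ℝ))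

/-- The standard orientation of `ℝⁿ`. -/
def stdOrientation (n : ℕ) : Orientation ℝ (EuclideanSpace ℝ (Fin n)) (Fin n) :=
  (EuclideanSpace.basisFun (Fin n) ℝ).toBasis.orientation

/-- The three-form
`φ₀ = dx₁₂₃ + dx₁₄₅ + dx₁₆₇ + dx₂₄₆ - dx₂₅₇ - dx₃₄₇ - dx₃₅₆` on `ℝ⁷`
(with indices shifted by one). -/
def phiZero : EuclideanSpace ℝ (Fin 7) [⋀^Fin 3]→ₗ[ℝ] ℝ :=
  dxForm ![0, 1, 2] + dxForm ![0, 3, 4] + dxForm ![0, 5, 6] + dxForm ![1, 3, 5]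
    - dxForm ![1, 4, 6] - dxForm ![2, 3, 6] - dxForm ![2, 4, 5]

/-- The four-form
`Ω₀ = dx₁₂₃₄ + dx₁₂₅₆ + dx₁₂₇₈ + dx₁₃₅₇ - dx₁₃₆₈ - dx₁₄₅₈ - dx₁₄₆₇
      - dx₂₃₅₈ - dx₂₃₆₇ - dx₂₄₅₇ + dx₂₄₆₈ + dx₃₄₅₆ + dx₃₄₇₈ + dx₅₆₇₈` on `ℝ⁸`
(with indices shifted by one). -/
def omegaZero : EuclideanSpace ℝ (Fin 8) [⋀^Fin 4]→ₗ[ℝ] ℝ :=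
  dxForm ![0, 1, 2, 3] + dxForm ![0, 1, 4, 5] + dxForm ![0, 1, 6, 7] + dxForm ![0, 2, 4, 6]
    - dxForm ![0, 2, 5, 7] - dxForm ![0, 3, 4, 7] - dxForm ![0, 3, 5, 6]
    - dxForm ![1, 2, 4, 7] - dxForm ![1, 2, 5, 6] - dxForm ![1, 3, 4, 6]
    + dxForm ![1, 3, 5, 7] + dxForm ![2, 3, 4, 5] + dxForm ![2, 3, 6, 7] + dxForm ![4, 5, 6, 7]

variable {V : Type*} [AddCommGroup V] [Module ℝ V]

/-- The exterior product of two alternating forms (sum over shuffles, without numerical factor). -/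
def wedgeForm {k l : ℕ} (α : V [⋀^Fin k]→ₗ[ℝ] ℝ) (β : V [⋀^Fin l]→ₗ[ℝ] ℝ) :
    V [⋀^Fin (k + l)]→ₗ[ℝ] ℝ :=
  ((LinearMap.mul' ℝ ℝ).compAlternatingMap (α.domCoprod β)).domDomCongr finSumFinEquiv

/-- A linear functional regarded as an alternating one-form. -/
def oneForm (θ : V →ₗ[ℝ] ℝ) : V [⋀^Fin 1]→ₗ[ℝ] ℝ :=
  AlternatingMap.ofSubsingleton ℝ V ℝ (0 : Fin 1) θ

/-- `γ = ∗β` with respect to the inner product `g` and the orientation `o` on an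
`n`-dimensional space, `n = k + l`: in a positively oriented `g`-orthonormal basis
`e₁, …, e_n`, one has `γ(e_{σ(k+1)}, …, e_{σ(n)}) = sgn(σ) β(e_{σ(1)}, …, e_{σ(k)})` for all
permutations `σ`, that is, `∗(e^{σ(1)} ∧ ⋯ ∧ e^{σ(k)}) = sgn(σ) e^{σ(k+1)} ∧ ⋯ ∧ e^{σ(n)}`.
(As usual, this does not depend on the choice of the basis, and it determines `γ`.) -/
def IsHodgeStar {k l : ℕ} (g : V → V → ℝ) (o : Orientation ℝ V (Fin (k + l)))
    (β : V [⋀^Fin k]→ₗ[ℝ] ℝ) (γ : V [⋀^Fin l]→ₗ[ℝ] ℝ) : Prop :=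
  ∃ e : Module.Basis (Fin (k + l)) ℝ V,
    e.orientation = o ∧ (∀ i j, g (e i) (e j) = if i = j then 1 else 0) ∧
      ∀ σ : Equiv.Perm (Fin (k + l)),
        γ (fun i => e (σ (Fin.natAdd k i))) =
          (Equiv.Perm.sign σ : ℤ) * β (fun i => e (σ (Fin.castAdd l i)))

/-- `f : ℝ⁷ → V` is an orientation-preserving isomorphism with `f^*φ = φ₀`. -/
def IsG2Frame (o : Orientation ℝ V (Fin 7)) (φ : V [⋀^Fin 3]→ₗ[ℝ] ℝ)
    (f : EuclideanSpace ℝ (Fin 7) ≃ₗ[ℝ] V) : Prop :=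
  Orientation.map (Fin 7) f (stdOrientation 7) = o ∧
    φ.compLinearMap (f : EuclideanSpace ℝ (Fin 7) →ₗ[ℝ] V) = phiZero

/-- Positive three-forms on an oriented seven-dimensional vector space. -/
def IsPositiveForm (o : Orientation ℝ V (Fin 7)) (φ : V [⋀^Fin 3]→ₗ[ℝ] ℝ) : Prop :=
  ∃ f : EuclideanSpace ℝ (Fin 7) ≃ₗ[ℝ] V, IsG2Frame o φ f

/-- `g` is the inner product induced by the positive three-form `φ`: an oriented isomorphism
`ℝ⁷ → V` that pulls `φ` back to `φ₀` pulls `g` back to the Euclidean inner product.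
(The stabilizer of `φ₀` is contained in `SO(7)`, so that `g` is unique.) -/
def IsG2InnerProduct (o : Orientation ℝ V (Fin 7)) (φ : V [⋀^Fin 3]→ₗ[ℝ] ℝ)
    (g : V → V → ℝ) : Prop :=
  ∃ f : EuclideanSpace ℝ (Fin 7) ≃ₗ[ℝ] V, IsG2Frame o φ f ∧ ∀ x y, g (f x) (f y) = inner ℝ x y

/-- `f : ℝ⁸ → V` is an orientation-preserving isomorphism with `f^*Ω = Ω₀`. -/
def IsSpin7Frame (o : Orientation ℝ V (Fin 8)) (Ω : V [⋀^Fin 4]→ₗ[ℝ] ℝ)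
    (f : EuclideanSpace ℝ (Fin 8) ≃ₗ[ℝ] V) : Prop :=
  Orientation.map (Fin 8) f (stdOrientation 8) = o ∧
    Ω.compLinearMap (f : EuclideanSpace ℝ (Fin 8) →ₗ[ℝ] V) = omegaZero

/-- Admissible four-forms on an oriented eight-dimensional vector space. -/
def IsAdmissibleForm (o : Orientation ℝ V (Fin 8)) (Ω : V [⋀^Fin 4]→ₗ[ℝ] ℝ) : Prop :=
  ∃ f : EuclideanSpace ℝ (Fin 8) ≃ₗ[ℝ] V, IsSpin7Frame o Ω f

/-- `g` is the inner product induced by the admissible four-form `Ω`: an oriented isomorphism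
`ℝ⁸ → V` that pulls `Ω` back to `Ω₀` pulls `g` back to the Euclidean inner product.
(The stabilizer of `Ω₀` is contained in `SO(8)`, so that `g` is unique.) -/
def IsSpin7InnerProduct (o : Orientation ℝ V (Fin 8)) (Ω : V [⋀^Fin 4]→ₗ[ℝ] ℝ)
    (g : V → V → ℝ) : Prop :=
  ∃ f : EuclideanSpace ℝ (Fin 8) ≃ₗ[ℝ] V,
    IsSpin7Frame o Ω f ∧ ∀ x y, g (f x) (f y) = inner ℝ x y

end LinearAlgebra

/-! ### Orientations, forms and metrics on manifolds -/

section Manifold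

/-- The tangent bundle of `M`, trivialized over the domain of the preferred chart at `x₀`. -/
abbrev tangentTriv (n : ℕ) {M : Type*} [TopologicalSpace M]
    [ChartedSpace (EuclideanSpace ℝ (Fin n)) M] [IsManifold (𝓡 n) ∞ M] (x₀ : M) :=
  trivializationAt (EuclideanSpace ℝ (Fin n)) (TangentSpace (𝓡 n) : M → Type _) x₀

/-- An orientation of an `n`-dimensional manifold: an orientation of each tangent space which,
in the coordinates of a chart, is locally constant. -/
structure ManifoldOrientation (n : ℕ) (M : Type*) [TopologicalSpace M]
    [ChartedSpace (EuclideanSpace ℝ (Fin n)) M] [IsManifold (𝓡 n) ∞ M] where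
  /-- the orientation of each tangent space -/
  at' : ∀ x : M, Orientation ℝ (TangentSpace (𝓡 n) x) (Fin n)
  locallyConstant : ∀ x₀ : M, ∀ᶠ x in 𝓝 x₀, ∃ hx : x ∈ (tangentTriv n x₀).baseSet,
    Orientation.map (Fin n) ((tangentTriv n x₀).linearEquivAt ℝ x hx) (at' x) =
      Orientation.map (Fin n) ((tangentTriv n x₀).linearEquivAt ℝ x₀
        (FiberBundle.mem_baseSet_trivializationAt' x₀)) (at' x₀)

/-- A (not necessarily smooth) differential `k`-form on `M`. -/
abbrev FormField (n k : ℕ) (M : Type*) [TopologicalSpace M]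
    [ChartedSpace (EuclideanSpace ℝ (Fin n)) M] :=
  ∀ x : M, TangentSpace (𝓡 n) x [⋀^Fin k]→ₗ[ℝ] ℝ

/-- A `k`-form is smooth if its components in the coordinate frames of charts are smooth. -/
def IsSmoothForm {n k : ℕ} {M : Type*} [TopologicalSpace M]
    [ChartedSpace (EuclideanSpace ℝ (Fin n)) M] [IsManifold (𝓡 n) ∞ M]
    (α : FormField n k M) : Prop :=
  ∀ (x₀ : M) (w : Fin k → EuclideanSpace ℝ (Fin n)),
    ContMDiffAt (𝓡 n) 𝓘(ℝ, ℝ) ∞ (fun x => α x fun i => (tangentTriv n x₀).symm x (w i)) x₀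

/-- A smooth Riemannian metric on an `n`-dimensional manifold. -/
abbrev SmoothMetric (n : ℕ) (M : Type*) [TopologicalSpace M]
    [ChartedSpace (EuclideanSpace ℝ (Fin n)) M] [IsManifold (𝓡 n) ∞ M] :=
  Bundle.ContMDiffRiemannianMetric (𝓡 n) ∞ (EuclideanSpace ℝ (Fin n))
    (fun x : M => TangentSpace (𝓡 n) x)

/-- The inner product of a Riemannian metric at a point. -/
def SmoothMetric.innerAt {n : ℕ} {M : Type*} [TopologicalSpace M]
    [ChartedSpace (EuclideanSpace ℝ (Fin n)) M] [IsManifold (𝓡 n) ∞ M]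
    (g : SmoothMetric n M) (x : M) (u w : TangentSpace (𝓡 n) x) : ℝ :=
  g.inner x u w

/-- A topological `G₂`-structure on a seven-dimensional manifold: an orientation and a smooth
three-form that is positive at every point. -/
structure G2Structure (N : Type*) [TopologicalSpace N]
    [ChartedSpace (EuclideanSpace ℝ (Fin 7)) N] [IsManifold (𝓡 7) ∞ N] where
  orientation : ManifoldOrientation 7 N
  form : FormField 7 3 N
  smooth : IsSmoothForm form
  positive : ∀ x, IsPositiveForm (orientation.at' x) (form x)

/-- `g` is the Riemannian metric induced by a topological `G₂`-structure. -/
def G2Structure.Induces {N : Type*} [TopologicalSpace N]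
    [ChartedSpace (EuclideanSpace ℝ (Fin 7)) N] [IsManifold (𝓡 7) ∞ N]
    (S : G2Structure N) (g : SmoothMetric 7 N) : Prop :=
  ∀ x, IsG2InnerProduct (S.orientation.at' x) (S.form x) (g.innerAt x)

/-- A topological `Spin(7)`-structure on an eight-dimensional manifold: an orientation and a
smooth four-form that is admissible at every point. -/
structure Spin7Structure (M : Type*) [TopologicalSpace M]
    [ChartedSpace (EuclideanSpace ℝ (Fin 8)) M] [IsManifold (𝓡 8) ∞ M] where
  orientation : ManifoldOrientation 8 M
  form : FormField 8 4 M
  smooth : IsSmoothForm form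
  admissible : ∀ x, IsAdmissibleForm (orientation.at' x) (form x)

/-- `g` is the Riemannian metric induced by a topological `Spin(7)`-structure. -/
def Spin7Structure.Induces {M : Type*} [TopologicalSpace M]
    [ChartedSpace (EuclideanSpace ℝ (Fin 8)) M] [IsManifold (𝓡 8) ∞ M]
    (T : Spin7Structure M) (g : SmoothMetric 8 M) : Prop :=
  ∀ x, IsSpin7InnerProduct (T.orientation.at' x) (T.form x) (g.innerAt x)

/-- The pullback of a `k`-form along a differentiable map. -/
def pullbackForm {m n k : ℕ} {M N : Type*}
    [TopologicalSpace M] [ChartedSpace (EuclideanSpace ℝ (Fin m)) M]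
    [TopologicalSpace N] [ChartedSpace (EuclideanSpace ℝ (Fin n)) N]
    (F : M → N) (α : FormField n k N) : FormField m k M :=
  fun x => (α (F x)).compLinearMap (mfderiv (𝓡 m) (𝓡 n) F x).toLinearMap

/-- The one-form `u^♭ = g(u, ·)`, for a vector field `u`. -/
def flatForm {n : ℕ} {M : Type*} [TopologicalSpace M]
    [ChartedSpace (EuclideanSpace ℝ (Fin n)) M] [IsManifold (𝓡 n) ∞ M]
    (g : SmoothMetric n M) (u : ∀ x : M, TangentSpace (𝓡 n) x) : FormField n 1 M :=
  fun x => oneForm (g.inner x (u x)).toLinearMap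

/-- A smooth submersion: smooth, with surjective differential everywhere. -/
def IsSmoothSubmersion (m n : ℕ) {M N : Type*}
    [TopologicalSpace M] [ChartedSpace (EuclideanSpace ℝ (Fin m)) M]
    [TopologicalSpace N] [ChartedSpace (EuclideanSpace ℝ (Fin n)) N] (F : M → N) : Prop :=
  ContMDiff (𝓡 m) (𝓡 n) ∞ F ∧ ∀ x, Function.Surjective (mfderiv (𝓡 m) (𝓡 n) F x)

/-- A Riemannian submersion: a smooth submersion whose differential is isometric on the
orthogonal complement of its kernel. -/
def IsRiemannianSubmersion {m n : ℕ} {M N : Type*}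
    [TopologicalSpace M] [ChartedSpace (EuclideanSpace ℝ (Fin m)) M] [IsManifold (𝓡 m) ∞ M]
    [TopologicalSpace N] [ChartedSpace (EuclideanSpace ℝ (Fin n)) N] [IsManifold (𝓡 n) ∞ N]
    (gM : SmoothMetric m M) (gN : SmoothMetric n N) (F : M → N) : Prop :=
  IsSmoothSubmersion m n F ∧
    ∀ (x : M) (u w : TangentSpace (𝓡 m) x),
      (∀ z : TangentSpace (𝓡 m) x, mfderiv (𝓡 m) (𝓡 n) F x z = 0 → gM.innerAt x z u = 0) →
      (∀ z : TangentSpace (𝓡 m) x, mfderiv (𝓡 m) (𝓡 n) F x z = 0 → gM.innerAt x z w = 0) →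
        gN.innerAt (F x) (mfderiv (𝓡 m) (𝓡 n) F x u) (mfderiv (𝓡 m) (𝓡 n) F x w) =
          gM.innerAt x u w

/-- The infinitesimal generator `v_p = d/dt|_{t = 0} (e^{it} • p)` of a circle action. -/
def circleGenerator {n : ℕ} {M : Type*} [TopologicalSpace M]
    [ChartedSpace (EuclideanSpace ℝ (Fin n)) M] [MulAction Circle M] (p : M) :
    TangentSpace (𝓡 n) p :=
  mfderiv 𝓘(ℝ, ℝ) (𝓡 n) (fun t : ℝ => Circle.exp t • p) 0 (1 : ℝ)

/-- The quotient map `M → M/S¹`. -/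
def circleQuotientMap (M : Type*) [MulAction Circle M] (p : M) :
    MulAction.orbitRel.Quotient Circle M :=
  Quotient.mk _ p

end Manifold

end

/-!
Let `θ` be an `S¹`-invariant one-form on `M` with `θ(v) = 1`, that is, a connection form, and let
`χ = ∗ψ` be the Hodge dual of the three-form on the seven-dimensional quotient. The structure
sought is `Ω = θ ∧ π^*ψ + π^*χ`, with metric `θ ⊗ θ + π^*g`. Indeed `Ω₀ = dx₁ ∧ φ₀ + ∗φ₀` on
`ℝ⁸ = ℝ ⊕ ℝ⁷` (`omegaZero_eq`), so a `G₂`-frame `f` of the quotient at `π p` yields the frame of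
`T_pM` whose inverse is `(θ, f⁻¹ ∘ dπ)` (`connectionFrame`), and this pulls `Ω` back to `Ω₀`. In
this frame `v` is the first basis vector, `θ = v^♭`, and `π^*χ` is the Hodge dual of `θ ∧ π^*ψ`
(`chiZero_star`). Invariance of `Ω` is that of `θ` and `π`. Two things are not formal.

* Smoothness of the metric and of `χ`. The `G₂`-frames are chosen pointwise, without any continuity,
  so both have to be recovered algebraically from the components of `ψ`. For a vector `u` let `W` be
  the matrix of `ψ(u, ·, ·)`, and let `α` be a covector with `α(u) = 1`. In a `G₂`-frame,
  `W² = u uᵀ - |u|²` gives `det (W + α αᵀ)² = |u|⁸` (`det_crossMatrix_add`). In a frame of volume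
  `±D` the determinant is multiplied by `D²`, and the fourth root of its square is `|D| |u|²`;
  polarization yields `|D|` times the Gram matrix, whose determinant `|D|⁹` yields `|D|`. Hence the
  metric is a smooth function of the components (`IsFrameComponents.contDiffAt_frameMetric`), and so
  is `χ`, by the identity `chiZero_apply`.

* Existence of the connection form (`exists_connection`). Every point has a neighbourhood `U` such
  that `z U` meets `U` only for `Re z > 0` (`exists_open_re_pos`). For functions `ρ` of a partition
  of unity subordinate to such sets, the averages `h(q) = ∫ e^{-it} ρ(e^{it} q) dt` are smooth,
  satisfy `h(z q) = z h(q)`, form a locally finite family and have no common zero. Then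
  `θ = (∑ Im (h̄ dh)) / ∑ |h|²` is a connection form. No slice theorem or local section is needed.

The tangent spaces of `M` are oriented by the frames. In coordinates the determinant of the inverse
frame is that of `(θ, dπ)`, which is continuous, times that of `f⁻¹`, whose sign is locally constant
because the quotient is oriented (`eventually_orientation_connectionFrame`).
-/

/-! ### The model forms on `ℝ⁷` and `ℝ⁸` -/

section
variable {V : Type*} [AddCommGroup V] [Module ℝ V]

/-- The wedge product with a one-form, written out: each term exchanges the first argument with one
of the four. -/
theorem wedgeForm_oneForm_apply (θ : V →ₗ[ℝ] ℝ) (β : V [⋀^Fin 3]→ₗ[ℝ] ℝ) (u : Fin (1 + 3) → V) :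
    wedgeForm (oneForm θ) β u =
      θ (u 0) * β ![u 1, u 2, u 3] - θ (u 1) * β ![u 0, u 2, u 3]
        - θ (u 2) * β ![u 1, u 0, u 3] - θ (u 3) * β ![u 1, u 2, u 0] := by
  -- `3! • (θ ∧ β)` is a sum over all permutations of four letters; these are grouped as pairs
  -- `(p, e)`, where `p` is the argument of `θ` and `e` permutes the arguments of `β`.
  have h := MultilinearMap.domCoprod_alternization_eq (oneForm θ) β
  have h2 := congrArg (fun F => LinearMap.mul' ℝ ℝ (F (u ∘ finSumFinEquiv))) h
  have h3 : LinearMap.mul' ℝ ℝ (((oneForm θ).domCoprod β) (u ∘ finSumFinEquiv)) =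
    wedgeForm (oneForm θ) β u := rfl
  simp only [AlternatingMap.smul_apply, map_nsmul, h3] at h2
  rw [MultilinearMap.alternatization_apply, map_sum] at h2
  rw [← Equiv.sum_comp (Equiv.permCongr (finSumFinEquiv (m := 1) (n := 3)).symm)] at h2
  rw [← Equiv.sum_comp (Equiv.Perm.decomposeFin (n := 3)).symm, Fintype.sum_prod_type] at h2
  have key : ∀ (p : Fin 4) (e : Equiv.Perm (Fin 3)),
      LinearMap.mul' ℝ ℝ
        (Equiv.Perm.sign (Equiv.permCongr (finSumFinEquiv (m := 1) (n := 3)).symm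
          (Equiv.Perm.decomposeFin.symm (p, e))) •
        (MultilinearMap.domDomCongr (Equiv.permCongr (finSumFinEquiv (m := 1) (n := 3)).symm
          (Equiv.Perm.decomposeFin.symm (p, e)))
          ((oneForm θ : MultilinearMap ℝ (fun _ : Fin 1 => V) ℝ).domCoprod
            (β : MultilinearMap ℝ (fun _ : Fin 3 => V) ℝ))) (u ∘ finSumFinEquiv)) =
      (if p = 0 then 1 else -1) * (θ (u p) * β (fun j => u (Equiv.swap 0 p j.succ))) := by
    intro p e
    have hb : β (fun j => u (Equiv.swap 0 p (e j).succ)) =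
      Equiv.Perm.sign e • β (fun j => u (Equiv.swap 0 p j.succ)) :=
        β.map_perm (fun j => u (Equiv.swap 0 p j.succ)) e
    have hc : ((oneForm θ : MultilinearMap ℝ (fun _ : Fin 1 => V) ℝ).domCoprod
            (β : MultilinearMap ℝ (fun _ : Fin 3 => V) ℝ)).domDomCongr
            (Equiv.permCongr (finSumFinEquiv (m := 1) (n := 3)).symm
          (Equiv.Perm.decomposeFin.symm (p, e))) (u ∘ finSumFinEquiv) =
        θ (u p) ⊗ₜ[ℝ] β (fun j => u (Equiv.swap 0 p (e j).succ)) := by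
      simp only [MultilinearMap.domDomCongr_apply, MultilinearMap.domCoprod_apply]
      congr 1
      · change θ (u _) = _
        congr 2
        simp only [Equiv.permCongr_apply, Equiv.symm_symm, Equiv.apply_symm_apply]
        exact Equiv.Perm.decomposeFin_symm_apply_zero p e
      · change β _ = _
        congr 1
        funext j
        simp only [Equiv.permCongr_apply, Function.comp_apply, Equiv.symm_symm,
          Equiv.apply_symm_apply]
        have hj : (finSumFinEquiv (Sum.inr j) : Fin (1 + 3)) = (Fin.succ j : Fin 4) :=
          Fin.ext (Nat.add_comm 1 j)
        rw [hj]
        exact congrArg u (Equiv.Perm.decomposeFin_symm_apply_succ e p j)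
    rw [hc, hb, Equiv.Perm.sign_permCongr, Equiv.Perm.decomposeFin.symm_sign]
    rcases Int.units_eq_one_or (Equiv.Perm.sign e) with h1 | h1 <;>
      by_cases hp : p = 0 <;> simp [h1, hp]
  simp only [key, Finset.sum_const, Finset.card_univ, Fintype.card_perm, Fintype.card_fin] at h2
  simp only [Fin.sum_univ_four] at h2
  have e0 : (fun j : Fin 3 => u (Equiv.swap 0 0 j.succ)) = ![u 1, u 2, u 3] := by
    funext j; fin_cases j <;> rfl
  have e1 : (fun j : Fin 3 => u (Equiv.swap 0 1 j.succ)) = ![u 0, u 2, u 3] := by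
    funext j; fin_cases j <;> rfl
  have e2 : (fun j : Fin 3 => u (Equiv.swap 0 2 j.succ)) = ![u 1, u 0, u 3] := by
    funext j; fin_cases j <;> rfl
  have e3 : (fun j : Fin 3 => u (Equiv.swap 0 3 j.succ)) = ![u 1, u 2, u 0] := by
    funext j; fin_cases j <;> rfl
  rw [e0, e1, e2, e3] at h2
  rw [if_pos trivial, if_neg (by decide), if_neg (by decide), if_neg (by decide)] at h2
  norm_num [Nat.factorial] at h2
  linarith

theorem wedgeForm_oneForm_compLinearMap {W : Type*} [AddCommGroup W] [Module ℝ W]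
    (θ : V →ₗ[ℝ] ℝ) (β : V [⋀^Fin 3]→ₗ[ℝ] ℝ) (f : W →ₗ[ℝ] V) :
    (wedgeForm (oneForm θ) β).compLinearMap f =
      wedgeForm (oneForm (θ ∘ₗ f)) (β.compLinearMap f) := by
  ext u
  simp only [AlternatingMap.compLinearMap_apply, wedgeForm_oneForm_apply, LinearMap.comp_apply]
  congr! <;> rename_i j <;> fin_cases j <;> rfl

/-- The four-form `∗φ₀` on `ℝ⁷`. -/
noncomputable def chiZero : EuclideanSpace ℝ (Fin 7) [⋀^Fin 4]→ₗ[ℝ] ℝ :=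
  dxForm ![3, 4, 5, 6] + dxForm ![1, 2, 5, 6] + dxForm ![1, 2, 3, 4] + dxForm ![0, 2, 4, 6]
    - dxForm ![0, 2, 3, 5] - dxForm ![0, 1, 4, 5] - dxForm ![0, 1, 3, 6]

/-- The projection `ℝ⁸ → ℝ⁷` which forgets the first coordinate. -/
noncomputable def tailProj : EuclideanSpace ℝ (Fin 8) →ₗ[ℝ] EuclideanSpace ℝ (Fin 7) where
  toFun w := WithLp.toLp 2 fun i => w i.succ
  map_add' _ _ := rfl
  map_smul' _ _ := rfl

/-- The first coordinate on `ℝ⁸`. -/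
noncomputable def headProj : EuclideanSpace ℝ (Fin 8) →ₗ[ℝ] ℝ where
  toFun w := w 0
  map_add' _ _ := rfl
  map_smul' _ _ := rfl

theorem dxForm_apply {n k : ℕ} (I : Fin k → Fin n) (u : Fin k → EuclideanSpace ℝ (Fin n)) :
    dxForm I u = Matrix.det (Matrix.of fun a b => u a (I b)) := rfl

theorem dxForm_three_apply {n : ℕ} (I : Fin 3 → Fin n) (x y z : EuclideanSpace ℝ (Fin n)) :
    dxForm I ![x, y, z] =
      x (I 0) * y (I 1) * z (I 2) - x (I 0) * y (I 2) * z (I 1)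
        - x (I 1) * y (I 0) * z (I 2) + x (I 1) * y (I 2) * z (I 0)
        + x (I 2) * y (I 0) * z (I 1) - x (I 2) * y (I 1) * z (I 0) := by
  rw [dxForm_apply, Matrix.det_fin_three]
  simp

/-- Expansion along the first column. -/
theorem dxForm_four_apply {n : ℕ} (I : Fin 4 → Fin n) (x y z w : EuclideanSpace ℝ (Fin n)) :
    dxForm I ![x, y, z, w] =
      x (I 0) * dxForm ![I 1, I 2, I 3] ![y, z, w] - y (I 0) * dxForm ![I 1, I 2, I 3] ![x, z, w]
        + z (I 0) * dxForm ![I 1, I 2, I 3] ![x, y, w]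
        - w (I 0) * dxForm ![I 1, I 2, I 3] ![x, y, z] := by
  have e1 : (Fin.succ 2 : Fin 4) = 3 := rfl
  have e3 : (Fin.succAbove 2 2 : Fin 4) = 3 := rfl
  have e4 : (Fin.succAbove 1 2 : Fin 4) = 3 := rfl
  have e5 : (Fin.succAbove 3 2 : Fin 4) = 2 := rfl
  have e6 : (Fin.succAbove 1 1 : Fin 4) = 2 := rfl
  have e7 : (Fin.succAbove 2 1 : Fin 4) = 1 := rfl
  have e8 : (Fin.succAbove 3 1 : Fin 4) = 1 := rfl
  rw [dxForm_apply, Matrix.det_succ_column_zero]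
  simp only [Fin.sum_univ_four, dxForm_three_apply, Matrix.det_fin_three, Matrix.of_apply,
    Matrix.submatrix_apply, Fin.succAbove_zero]
  simp [e1, e3, e4, e5, e6, e7, e8]
  ring

theorem wedgeForm_headProj_dxForm (I : Fin 3 → Fin 8) :
    wedgeForm (oneForm headProj) (dxForm I) = (dxForm ![0, I 0, I 1, I 2] :
      EuclideanSpace ℝ (Fin 8) [⋀^Fin 4]→ₗ[ℝ] ℝ) := by
  refine AlternatingMap.ext fun (u : Fin 4 → EuclideanSpace ℝ (Fin 8)) => ?_
  refine (wedgeForm_oneForm_apply headProj (dxForm I) u).trans ?_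
  have hu : u = ![u 0, u 1, u 2, u 3] := by funext j; fin_cases j <;> rfl
  conv_rhs => rw [hu, dxForm_four_apply]
  have h0 : ∀ w, headProj w = w 0 := fun _ => rfl
  simp only [dxForm_three_apply, h0]
  simp
  ring

theorem chiZero_compLinearMap_tailProj :
    chiZero.compLinearMap tailProj =
      dxForm ![4, 5, 6, 7] + dxForm ![2, 3, 6, 7] + dxForm ![2, 3, 4, 5] + dxForm ![1, 3, 5, 7]
        - dxForm ![1, 3, 4, 6] - dxForm ![1, 2, 5, 6] - dxForm ![1, 2, 4, 7] := by
  have h : ∀ (I : Fin 4 → Fin 7) (J : Fin 4 → Fin 8), (∀ b, (I b).succ = J b) →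
      ∀ u, dxForm I (fun i => tailProj (u i)) = dxForm J u := by
    intro I J hIJ u
    rw [← funext hIJ]
    rfl
  ext u
  simp only [chiZero, AlternatingMap.compLinearMap_apply, AlternatingMap.add_apply,
    AlternatingMap.sub_apply]
  rw [h ![3, 4, 5, 6] ![4, 5, 6, 7] (by decide), h ![1, 2, 5, 6] ![2, 3, 6, 7] (by decide),
    h ![1, 2, 3, 4] ![2, 3, 4, 5] (by decide), h ![0, 2, 4, 6] ![1, 3, 5, 7] (by decide),
    h ![0, 2, 3, 5] ![1, 3, 4, 6] (by decide), h ![0, 1, 4, 5] ![1, 2, 5, 6] (by decide),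
    h ![0, 1, 3, 6] ![1, 2, 4, 7] (by decide)]

theorem wedgeForm_headProj_phiZero :
    wedgeForm (oneForm headProj) (phiZero.compLinearMap tailProj) =
      (dxForm ![0, 1, 2, 3] + dxForm ![0, 1, 4, 5] + dxForm ![0, 1, 6, 7] + dxForm ![0, 2, 4, 6]
        - dxForm ![0, 2, 5, 7] - dxForm ![0, 3, 4, 7] - dxForm ![0, 3, 5, 6] :
        EuclideanSpace ℝ (Fin 8) [⋀^Fin 4]→ₗ[ℝ] ℝ) := by
  have hw : ∀ α β : EuclideanSpace ℝ (Fin 8) [⋀^Fin 3]→ₗ[ℝ] ℝ,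
      wedgeForm (oneForm headProj) (α + β) =
        wedgeForm (oneForm headProj) α + wedgeForm (oneForm headProj) β := by
    intro α β
    ext u
    simp only [wedgeForm_oneForm_apply, AlternatingMap.add_apply]
    ring
  have hw' : ∀ α β : EuclideanSpace ℝ (Fin 8) [⋀^Fin 3]→ₗ[ℝ] ℝ,
      wedgeForm (oneForm headProj) (α - β) =
        wedgeForm (oneForm headProj) α - wedgeForm (oneForm headProj) β := by
    intro α β
    ext u
    simp only [wedgeForm_oneForm_apply, AlternatingMap.sub_apply]
    ring
  have hφ : phiZero.compLinearMap tailProj =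
      dxForm ![1, 2, 3] + dxForm ![1, 4, 5] + dxForm ![1, 6, 7] + dxForm ![2, 4, 6]
        - dxForm ![2, 5, 7] - dxForm ![3, 4, 7] - dxForm ![3, 5, 6] := by
    have h : ∀ (I : Fin 3 → Fin 7) (J : Fin 3 → Fin 8), (∀ b, (I b).succ = J b) →
        ∀ u, dxForm I (fun i => tailProj (u i)) = dxForm J u := by
      intro I J hIJ u
      rw [← funext hIJ]
      rfl
    ext u
    simp only [phiZero, AlternatingMap.compLinearMap_apply, AlternatingMap.add_apply,
      AlternatingMap.sub_apply]
    rw [h ![0, 1, 2] ![1, 2, 3] (by decide), h ![0, 3, 4] ![1, 4, 5] (by decide),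
      h ![0, 5, 6] ![1, 6, 7] (by decide), h ![1, 3, 5] ![2, 4, 6] (by decide),
      h ![1, 4, 6] ![2, 5, 7] (by decide), h ![2, 3, 6] ![3, 4, 7] (by decide),
      h ![2, 4, 5] ![3, 5, 6] (by decide)]
  rw [hφ]
  simp only [hw, hw', wedgeForm_headProj_dxForm]
  simp only [Matrix.cons_val]

/-- With respect to `ℝ⁸ = ℝ ⊕ ℝ⁷`, one has `Ω₀ = dx₁ ∧ φ₀ + ∗φ₀`. -/
theorem omegaZero_eq :
    omegaZero = (wedgeForm (oneForm headProj) (phiZero.compLinearMap tailProj) :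
      EuclideanSpace ℝ (Fin 8) [⋀^Fin 4]→ₗ[ℝ] ℝ) + chiZero.compLinearMap tailProj := by
  rw [chiZero_compLinearMap_tailProj, omegaZero]
  refine Eq.trans ?_ (congrArg (· + _) wedgeForm_headProj_phiZero.symm)
  abel

/-- Complementary minors of a permutation matrix agree up to the sign of the permutation. -/
theorem dxForm_complement {k l : ℕ} (σ τ : Equiv.Perm (Fin (k + l))) :
    dxForm (fun i => τ (Fin.natAdd k i))
        (fun i => EuclideanSpace.basisFun (Fin (k + l)) ℝ (σ (Fin.natAdd k i))) =
      (Equiv.Perm.sign σ : ℤ) * ((Equiv.Perm.sign τ : ℤ) *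
        dxForm (fun i => τ (Fin.castAdd l i))
          (fun i => EuclideanSpace.basisFun (Fin (k + l)) ℝ (σ (Fin.castAdd l i)))) := by
  set P : Matrix (Fin k ⊕ Fin l) (Fin k ⊕ Fin l) ℝ :=
    ((τ⁻¹ * σ).toPEquiv.toMatrix).submatrix finSumFinEquiv finSumFinEquiv with hP
  have hdet : P.det = (Equiv.Perm.sign σ : ℤ) * (Equiv.Perm.sign τ : ℤ) := by
    rw [hP, Matrix.det_submatrix_equiv_self, Matrix.det_permutation]
    simp [mul_comm]
  have hentry : ∀ i j, P i j = if σ (finSumFinEquiv i) = τ (finSumFinEquiv j) then 1 else 0 := by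
    intro i j
    rw [hP, Matrix.submatrix_apply, PEquiv.toMatrix_apply]
    simp [Equiv.eq_symm_apply, eq_comm]
  have horth : P * P.transpose = 1 := by
    ext i j
    rw [Matrix.mul_apply, ← finSumFinEquiv.symm.sum_comp, ← Equiv.sum_comp τ⁻¹]
    simp [hentry, Matrix.one_apply]
  have hA : dxForm (fun i => τ (Fin.castAdd l i))
          (fun i => EuclideanSpace.basisFun (Fin (k + l)) ℝ (σ (Fin.castAdd l i))) =
          P.toBlocks₁₁.det := by
    rw [dxForm_apply]
    congr 1
    ext i j
    simp [hentry, Matrix.toBlocks₁₁, eq_comm (a := τ _)]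
    congr
  have hD : dxForm (fun i => τ (Fin.natAdd k i))
          (fun i => EuclideanSpace.basisFun (Fin (k + l)) ℝ (σ (Fin.natAdd k i))) =
          P.toBlocks₂₂.det := by
    rw [dxForm_apply]
    congr 1
    ext i j
    simp [hentry, Matrix.toBlocks₂₂, eq_comm (a := τ _)]
    congr
  rw [hA, hD, ← mul_assoc, ← hdet]
  -- Jacobi's identity for the orthogonal matrix `P`, from
  -- `P * [[P₁₁ᵀ, 0], [P₁₂ᵀ, 1]] = [[1, P₁₂], [0, P₂₂]]`.
  have hPb := Matrix.fromBlocks_toBlocks P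
  have h1 : P * Matrix.fromBlocks P.toBlocks₁₁.transpose 0 P.toBlocks₁₂.transpose 1 =
      Matrix.fromBlocks 1 P.toBlocks₁₂ 0 P.toBlocks₂₂ := by
    rw [← hPb, Matrix.fromBlocks_transpose, Matrix.fromBlocks_multiply, ← Matrix.fromBlocks_one,
      Matrix.fromBlocks_inj] at horth
    conv_lhs => rw [← hPb]
    rw [Matrix.fromBlocks_multiply]
    simp [horth.1, horth.2.2.1]
  have h2 := congrArg Matrix.det h1
  rw [Matrix.det_mul, Matrix.det_fromBlocks_zero₁₂, Matrix.det_fromBlocks_zero₂₁] at h2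
  simpa using h2.symm

/-- On `ℝ⁸`, the form `∗φ₀` pulled back from `ℝ⁷` is the Hodge dual of `dx₁ ∧ φ₀`: term by term,
the summands are `dx_I` and `dx_J` with equal signs and `(I, J)` an even permutation. -/
theorem chiZero_star (σ : Equiv.Perm (Fin (4 + 4))) :
    chiZero.compLinearMap tailProj
        (fun i => EuclideanSpace.basisFun (Fin 8) ℝ (σ (Fin.natAdd 4 i))) =
      (Equiv.Perm.sign σ : ℤ) * (wedgeForm (oneForm headProj) (phiZero.compLinearMap tailProj))
        (fun i => EuclideanSpace.basisFun (Fin 8) ℝ (σ (Fin.castAdd 4 i))) := by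
  have key : ∀ (I J : Fin 4 → Fin 8) (τ : Equiv.Perm (Fin 8)),
      (∀ i, τ (Fin.castAdd 4 i) = I i) → (∀ i, τ (Fin.natAdd 4 i) = J i) →
      (Equiv.Perm.sign τ : ℤ) = 1 →
      dxForm J (fun i => EuclideanSpace.basisFun (Fin 8) ℝ (σ (Fin.natAdd 4 i))) =
        (Equiv.Perm.sign σ : ℤ) *
          dxForm I (fun i => EuclideanSpace.basisFun (Fin 8) ℝ (σ (Fin.castAdd 4 i))) := by
    intro I J τ hI hJ hs
    have h := dxForm_complement (k := 4) (l := 4) σ τ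
    rw [funext hI, funext hJ, hs, Int.cast_one, one_mul] at h
    exact h
  have h0 := key ![0, 1, 2, 3] ![4, 5, 6, 7] 1 (by decide) (by decide)
    (by simp)
  have h1 := key ![0, 1, 4, 5] ![2, 3, 6, 7] (Equiv.swap 2 4 * Equiv.swap 3 5)
    (by decide) (by decide) (by simp [Equiv.Perm.sign_mul])
  have h2 := key ![0, 1, 6, 7] ![2, 3, 4, 5]
    (Equiv.swap 2 6 * Equiv.swap 3 7 * Equiv.swap 4 6 * Equiv.swap 5 7)
    (by decide) (by decide) (by simp [Equiv.Perm.sign_mul])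
  have h3 := key ![0, 2, 4, 6] ![1, 3, 5, 7]
    (Equiv.swap 1 2 * Equiv.swap 2 4 * Equiv.swap 3 6 * Equiv.swap 5 6)
    (by decide) (by decide) (by simp [Equiv.Perm.sign_mul])
  have h4 := key ![0, 2, 5, 7] ![1, 3, 4, 6]
    (Equiv.swap 1 2 * Equiv.swap 2 5 * Equiv.swap 3 7 * Equiv.swap 4 5 * Equiv.swap 5 7 *
      Equiv.swap 6 7)
    (by decide) (by decide) (by simp [Equiv.Perm.sign_mul])
  have h5 := key ![0, 3, 4, 7] ![1, 2, 5, 6]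
    (Equiv.swap 1 3 * Equiv.swap 2 4 * Equiv.swap 3 7 * Equiv.swap 4 7 * Equiv.swap 5 7 *
      Equiv.swap 6 7)
    (by decide) (by decide) (by simp [Equiv.Perm.sign_mul])
  have h6 := key ![0, 3, 5, 6] ![1, 2, 4, 7]
    (Equiv.swap 1 3 * Equiv.swap 2 5 * Equiv.swap 3 6 * Equiv.swap 4 6)
    (by decide) (by decide) (by simp [Equiv.Perm.sign_mul])
  rw [chiZero_compLinearMap_tailProj]
  have hφ := congrArg
    (fun F => F (fun i => EuclideanSpace.basisFun (Fin 8) ℝ (σ (Fin.castAdd 4 i))))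
    wedgeForm_headProj_phiZero
  refine Eq.trans ?_ (congrArg (_ * ·) hφ.symm)
  simp only [AlternatingMap.add_apply, AlternatingMap.sub_apply]
  rw [h0, h1, h2, h3, h4, h5, h6]
  ring
end

/-! ### The metric and the dual four-form of a positive three-form -/

section
open Matrix

/-- The matrix of the two-form `φ₀(u, ·, ·)` on `ℝ⁷`, i.e. of the cross product with `u`. -/
def crossMatrix (u : Fin 7 → ℝ) : Matrix (Fin 7) (Fin 7) ℝ :=
  !![0, u 2, -u 1, u 4, -u 3, u 6, -u 5;
     -u 2, 0, u 0, u 5, -u 6, -u 3, u 4;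
     u 1, -u 0, 0, -u 6, -u 5, u 4, u 3;
     -u 4, -u 5, u 6, 0, u 0, u 1, -u 2;
     u 3, u 6, u 5, -u 0, 0, -u 2, -u 1;
     -u 6, u 3, -u 4, -u 1, u 2, 0, u 0;
     u 5, -u 4, -u 3, u 2, u 1, -u 0, 0]

theorem phiZero_apply (x y z : EuclideanSpace ℝ (Fin 7)) :
    phiZero ![x, y, z] = dotProduct y (crossMatrix x *ᵥ z) := by
  simp only [phiZero, AlternatingMap.add_apply, AlternatingMap.sub_apply, dxForm_three_apply,
    dotProduct, mulVec, Fin.sum_univ_seven, crossMatrix]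
  simp
  ring

theorem crossMatrix_transpose (u : Fin 7 → ℝ) : (crossMatrix u)ᵀ = -crossMatrix u := by
  ext i j
  fin_cases i <;> fin_cases j <;> simp [crossMatrix]

theorem crossMatrix_mulVec_self (u : Fin 7 → ℝ) : crossMatrix u *ᵥ u = 0 := by
  ext i
  fin_cases i <;> simp [crossMatrix, mulVec, dotProduct, Fin.sum_univ_seven] <;> ring

theorem crossMatrix_mul_self (u : Fin 7 → ℝ) :
    crossMatrix u * crossMatrix u = vecMulVec u u - (u ⬝ᵥ u) • (1 : Matrix (Fin 7) (Fin 7) ℝ) := by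
  ext i j
  fin_cases i <;> fin_cases j <;>
    simp [crossMatrix, mul_apply, dotProduct, Fin.sum_univ_seven, vecMulVec_apply] <;> ring

/-- The dual four-form `∗φ₀` in terms of `φ₀` and the metric (the contraction identity of `φ₀` with
itself); in this form it can be evaluated in any frame. -/
theorem chiZero_apply (x y z w : EuclideanSpace ℝ (Fin 7)) :
    chiZero ![x, y, z, w] =
      (∑ p, phiZero ![x, y, EuclideanSpace.basisFun (Fin 7) ℝ p] *
        phiZero ![z, w, EuclideanSpace.basisFun (Fin 7) ℝ p])
        - inner ℝ x z * inner ℝ y w + inner ℝ x w * inner ℝ y z := by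
  simp only [chiZero, phiZero, AlternatingMap.add_apply, AlternatingMap.sub_apply,
    dxForm_three_apply, dxForm_four_apply, Fin.sum_univ_seven, PiLp.inner_apply]
  simp
  ring
end

section
open Matrix

/-- With `W` the matrix of the cross product with `u`, the identities `W² = u uᵀ - |u|² 1` and
`W u = 0` give `(W + u uᵀ)(W + u uᵀ)ᵀ = |u|² 1 + (|u|⁴ - |u|²) û ûᵀ`, where `û = u / |u|`. -/
theorem det_crossMatrix_add_self (u : Fin 7 → ℝ) :
    (crossMatrix u + vecMulVec u u).det ^ 2 = (u ⬝ᵥ u) ^ 8 := by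
  set s := u ⬝ᵥ u with hs
  by_cases h0 : s = 0
  · have hu : u = 0 := dotProduct_self_eq_zero.mp h0
    subst hu
    have : crossMatrix 0 + vecMulVec 0 0 = 0 := by
      ext i j
      fin_cases i <;> fin_cases j <;> simp [crossMatrix]
    rw [this, h0]; simp
  have h1 : (crossMatrix u + vecMulVec u u) * (crossMatrix u + vecMulVec u u)ᵀ =
      s • (1 + vecMulVec (((s - 1) / s) • u) u) := by
    rw [transpose_add, crossMatrix_transpose, transpose_vecMulVec, add_mul, mul_add, mul_add,
      mul_neg, crossMatrix_mul_self, mul_neg, vecMulVec_mul, mul_vecMulVec, crossMatrix_mulVec_self,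
      ← mulVec_transpose, crossMatrix_transpose, neg_mulVec, crossMatrix_mulVec_self,
      vecMulVec_mul_vecMulVec, ← hs]
    ext i j
    simp [vecMulVec_apply]
    field_simp
    ring
  have h2 := congrArg det h1
  rw [det_mul, det_transpose, det_smul, vecMulVec_eq Unit (_ • u),
    det_one_add_replicateCol_mul_replicateRow] at h2
  rw [pow_two, h2]
  simp [← hs]
  field_simp
  ring

/-- The value of `det (W + α αᵀ)` up to sign, for the cross product matrix `W` with `u`, does not
depend on the covector `α` normalized by `α(u) = 1`, so that it can be computed from any basis. -/
theorem det_crossMatrix_add (u a : Fin 7 → ℝ) (h : a ⬝ᵥ u = 1) :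
    (crossMatrix u + vecMulVec a a).det ^ 2 = (u ⬝ᵥ u) ^ 4 := by
  set s := u ⬝ᵥ u with hs
  have h0 : s ≠ 0 := by
    intro h0
    have hu : u = 0 := dotProduct_self_eq_zero.mp h0
    simp [hu] at h
  have hd := det_crossMatrix_add_self u
  set w := crossMatrix u *ᵥ a with hw
  have hwu : w ⬝ᵥ u = 0 := by
    rw [hw, dotProduct_comm, dotProduct_mulVec, ← mulVec_transpose, crossMatrix_transpose,
      neg_mulVec, crossMatrix_mulVec_self]
    simp
  have hwa : w ⬝ᵥ a = 0 := by
    have : w ⬝ᵥ a = - (w ⬝ᵥ a) := by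
      conv_lhs => rw [hw, dotProduct_comm, dotProduct_mulVec, ← mulVec_transpose,
        crossMatrix_transpose, neg_mulVec, ← hw, neg_dotProduct]
    linarith
  -- Multiplied by `(W + u uᵀ)ᵀ`, the matrix becomes a rank-two perturbation of `|u|² 1`.
  have h1 : (crossMatrix u + vecMulVec a a) * (crossMatrix u + vecMulVec u u)ᵀ =
      s • (1 + (of ![-(1 / s) • u, (1 / s) • a])ᵀ * of ![u, w + u]) := by
    rw [transpose_add, crossMatrix_transpose, transpose_vecMulVec, add_mul, mul_add, mul_add,
      mul_neg, crossMatrix_mul_self, mul_neg, vecMulVec_mul, mul_vecMulVec, crossMatrix_mulVec_self,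
      ← mulVec_transpose, crossMatrix_transpose, neg_mulVec,
      vecMulVec_mul_vecMulVec, ← hs, ← hw, h]
    ext i j
    simp [vecMulVec_apply, mul_apply]
    field_simp
    ring
  have h2 := congrArg det h1
  have h3 : (of ![u, w + u]) * (of ![-(1 / s) • u, (1 / s) • a])ᵀ = !![-1, 1 / s; -1, 1 / s] := by
    have e1 : (of ![u, w + u]) * (of ![-(1 / s) • u, (1 / s) • a])ᵀ =
      !![u ⬝ᵥ (-(1 / s) • u), u ⬝ᵥ ((1 / s) • a);
        (w + u) ⬝ᵥ (-(1 / s) • u), (w + u) ⬝ᵥ ((1 / s) • a)] := by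
      ext i j
      fin_cases i <;> fin_cases j <;> rfl
    rw [e1, add_dotProduct, add_dotProduct]
    simp only [dotProduct_smul, hwu, hwa, ← hs, dotProduct_comm u a, h]
    ext i j
    fin_cases i <;> fin_cases j <;> simp [h0]
  rw [det_mul, det_transpose, det_smul, det_one_add_mul_comm, h3] at h2
  have h4 : det (1 + !![-1, 1 / s; -1, 1 / s]) = 1 / s := by
    rw [det_fin_two]
    simp
  rw [h4] at h2
  have h5 := congrArg (· ^ 2) h2
  simp only [mul_pow, hd] at h5
  have h6 : s ^ 8 ≠ 0 := pow_ne_zero _ h0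
  apply mul_right_cancel₀ h6
  rw [h5]
  simp
  field_simp

/-- `frameNormSq T c a` is `|D| |u|²` if `T` holds the components of a positive three-form in a
frame of volume `±D`, `c` holds the components of `u`, and `a` those of a covector with
`a(u) = 1`. -/
noncomputable def frameNormSq (T : Fin 7 → Fin 7 → Fin 7 → ℝ) (c a : Fin 7 → ℝ) : ℝ :=
  √√((of fun i j => (∑ l, c l * T l i j) + a i * a j).det ^ 2)

theorem frameNormSq_eq {T : Fin 7 → Fin 7 → Fin 7 → ℝ} {P : Matrix (Fin 7) (Fin 7) ℝ}
    (hP : P.det ≠ 0) (c a : Fin 7 → ℝ) (hca : a ⬝ᵥ c = 1)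
    (hT : ∀ i j, ∑ l, c l * T l i j = (Pᵀ * crossMatrix (P *ᵥ c) * P) i j) :
    frameNormSq T c a = |P.det| * ((P *ᵥ c) ⬝ᵥ (P *ᵥ c)) := by
  have hu : IsUnit P.det := hP.isUnit
  set b := (P⁻¹)ᵀ *ᵥ a with hb
  have hPb : Pᵀ *ᵥ b = a := by
    rw [hb, mulVec_mulVec, ← transpose_mul, nonsing_inv_mul _ hu, transpose_one, one_mulVec]
  have hbu : b ⬝ᵥ (P *ᵥ c) = 1 := by
    rw [dotProduct_mulVec, ← mulVec_transpose, hPb, hca]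
  have h1 : (of fun i j => (∑ l, c l * T l i j) + a i * a j) =
      Pᵀ * (crossMatrix (P *ᵥ c) + vecMulVec b b) * P := by
    rw [mul_add, add_mul, mul_vecMulVec, vecMulVec_mul, ← mulVec_transpose, hPb]
    ext i j
    rw [of_apply, hT, Matrix.add_apply, vecMulVec_apply]
  rw [frameNormSq, h1, det_mul, det_mul, det_transpose]
  have h2 : (P.det * (crossMatrix (P *ᵥ c) + vecMulVec b b).det * P.det) ^ 2 =
      ((P.det ^ 2) * ((P *ᵥ c) ⬝ᵥ (P *ᵥ c)) ^ 2) ^ 2 := by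
    rw [mul_pow, mul_pow, det_crossMatrix_add _ _ hbu]
    ring
  have hnn : 0 ≤ (P *ᵥ c) ⬝ᵥ (P *ᵥ c) := dotProduct_self_star_nonneg _
  rw [h2, Real.sqrt_sq (by positivity), Real.sqrt_mul (by positivity), Real.sqrt_sq hnn,
    Real.sqrt_sq_eq_abs]

/-- `|D|` times the Gram matrix of the frame, where `|D|` is its volume and `T` holds the components
of the three-form, obtained from `frameNormSq` by polarization. The covector `eᵢ` takes the value
`1` both on `eᵢ` and on `eᵢ + eⱼ`, as `frameNormSq` demands. -/
noncomputable def frameGram (T : Fin 7 → Fin 7 → Fin 7 → ℝ) : Matrix (Fin 7) (Fin 7) ℝ :=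
  of fun i j =>
    if i = j then frameNormSq T (Pi.single i 1) (Pi.single i 1)
    else (frameNormSq T (Pi.single i 1 + Pi.single j 1) (Pi.single i 1)
      - frameNormSq T (Pi.single i 1) (Pi.single i 1)
      - frameNormSq T (Pi.single j 1) (Pi.single j 1)) / 2

/-- The Gram matrix of a frame in the metric of a positive three-form, as a function of the
components of the three-form in the frame. The Gram matrix has determinant `D²`, so that
`frameGram T` has determinant `|D|⁹`: this recovers `|D|`. -/
noncomputable def frameMetric (T : Fin 7 → Fin 7 → Fin 7 → ℝ) : Matrix (Fin 7) (Fin 7) ℝ :=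
  of fun i j => frameGram T i j / (frameGram T).det ^ (1 / 9 : ℝ)

/-- `T` holds the components of a positive three-form in a frame; the columns of `P` are the
coordinates of that frame in a frame in which the three-form is `φ₀`. -/
def IsFrameComponents (T : Fin 7 → Fin 7 → Fin 7 → ℝ) (P : Matrix (Fin 7) (Fin 7) ℝ) : Prop :=
  P.det ≠ 0 ∧ ∀ c i j, ∑ l, c l * T l i j = (Pᵀ * crossMatrix (P *ᵥ c) * P) i j

variable {T : Fin 7 → Fin 7 → Fin 7 → ℝ} {P : Matrix (Fin 7) (Fin 7) ℝ}

theorem IsFrameComponents.frameGram_eq (h : IsFrameComponents T P) :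
    frameGram T = |P.det| • (Pᵀ * P) := by
  have hq := fun c a hca => frameNormSq_eq h.1 c a hca (h.2 c)
  ext i j
  have hPP : (Pᵀ * P) i j = P.col i ⬝ᵥ P.col j := rfl
  have hi : frameNormSq T (Pi.single i 1) (Pi.single i 1) = |P.det| * (P.col i ⬝ᵥ P.col i) := by
    rw [hq _ _ (by simp), mulVec_single_one]
  have hj : frameNormSq T (Pi.single j 1) (Pi.single j 1) = |P.det| * (P.col j ⬝ᵥ P.col j) := by
    rw [hq _ _ (by simp), mulVec_single_one]
  rw [frameGram, of_apply, Matrix.smul_apply, hPP, smul_eq_mul]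
  split_ifs with hij
  · subst hij
    rw [hi]
  · rw [hi, hj, hq _ _ (by simp [hij]), mulVec_add, mulVec_single_one, mulVec_single_one,
      add_dotProduct, dotProduct_add, dotProduct_add, dotProduct_comm (P.col j) (P.col i)]
    ring

theorem IsFrameComponents.det_frameGram (h : IsFrameComponents T P) :
    (frameGram T).det = |P.det| ^ 9 := by
  rw [h.frameGram_eq, det_smul, det_mul, det_transpose, Fintype.card_fin, ← abs_mul_abs_self]
  ring

theorem IsFrameComponents.frameMetric_eq (h : IsFrameComponents T P) :
    frameMetric T = Pᵀ * P := by
  have h0 : 0 < |P.det| := abs_pos.mpr h.1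
  ext i j
  rw [frameMetric, of_apply, h.det_frameGram, h.frameGram_eq, Matrix.smul_apply, smul_eq_mul,
    ← Real.rpow_natCast, ← Real.rpow_mul h0.le]
  norm_num
  field_simp

theorem contDiffAt_det {E : Type*} [NormedAddCommGroup E] [NormedSpace ℝ E] {n : WithTop ℕ∞}
    {ι : Type*} [Fintype ι] [DecidableEq ι] {A : E → Matrix ι ι ℝ} {x : E}
    (hA : ∀ i j, ContDiffAt ℝ n (fun y => A y i j) x) : ContDiffAt ℝ n (fun y => (A y).det) x := by
  simp only [det_apply]
  refine ContDiffAt.sum fun σ _ => ContDiffAt.const_smul _ ?_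
  exact contDiffAt_prod fun i _ => hA _ _

theorem IsFrameComponents.contDiffAt_frameNormSq (h : IsFrameComponents T P) (c a : Fin 7 → ℝ)
    (hca : a ⬝ᵥ c = 1) : ContDiffAt ℝ ∞ (fun T' => frameNormSq T' c a) T := by
  have hpos : 0 < frameNormSq T c a := by
    rw [frameNormSq_eq h.1 c a hca (h.2 c)]
    refine mul_pos (abs_pos.mpr h.1) (lt_of_le_of_ne (dotProduct_self_star_nonneg _) ?_)
    intro h0
    have h1 : P *ᵥ c = 0 := dotProduct_self_eq_zero.mp h0.symm
    have h2 : c = 0 := eq_zero_of_mulVec_eq_zero h.1 h1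
    simp [h2] at hca
  have h1 := Real.sqrt_pos.mp hpos
  have h2 := Real.sqrt_pos.mp h1
  unfold frameNormSq
  refine ContDiffAt.sqrt (ContDiffAt.sqrt (ContDiffAt.pow (contDiffAt_det fun i j => ?_) 2) h2.ne')
    h1.ne'
  simp only [of_apply]
  fun_prop

/-- The metric depends smoothly on the three-form: the square roots in `frameNormSq` and the power
in `frameMetric` are taken of positive numbers. -/
theorem IsFrameComponents.contDiffAt_frameMetric (h : IsFrameComponents T P) (i j : Fin 7) :
    ContDiffAt ℝ ∞ (fun T' => frameMetric T' i j) T := by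
  have hG : ∀ i j, ContDiffAt ℝ ∞ (fun T' => frameGram T' i j) T := by
    intro i j
    have hi := h.contDiffAt_frameNormSq (Pi.single i 1) (Pi.single i 1) (by simp)
    have hj := h.contDiffAt_frameNormSq (Pi.single j 1) (Pi.single j 1) (by simp)
    simp only [frameGram, of_apply]
    split_ifs with hij
    · exact hi
    · have hk := h.contDiffAt_frameNormSq (Pi.single i 1 + Pi.single j 1) (Pi.single i 1)
        (by simp [hij])
      exact ((hk.sub hi).sub hj).div_const 2
  have h0 : 0 < (frameGram T).det := by
    rw [h.det_frameGram]
    exact pow_pos (abs_pos.mpr h.1) 9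
  simp only [frameMetric, of_apply]
  exact (hG i j).div ((contDiffAt_det hG).rpow_const_of_ne h0.ne') (Real.rpow_pos_of_pos h0 _).ne'
end

section
open Matrix

theorem IsFrameComponents.contDiffAt_frameMetric_inv {T : Fin 7 → Fin 7 → Fin 7 → ℝ}
    {P : Matrix (Fin 7) (Fin 7) ℝ} (h : IsFrameComponents T P) (i j : Fin 7) :
    ContDiffAt ℝ ∞ (fun T' => (frameMetric T')⁻¹ i j) T := by
  have hd : (frameMetric T).det ≠ 0 := by
    rw [h.frameMetric_eq, det_mul, det_transpose]
    exact mul_ne_zero h.1 h.1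
  simp only [Matrix.inv_def, Ring.inverse_eq_inv', Matrix.smul_apply, smul_eq_mul, adjugate_apply]
  refine ((contDiffAt_det h.contDiffAt_frameMetric).inv hd).mul (contDiffAt_det fun k l => ?_)
  simp only [updateRow_apply]
  split_ifs
  · exact contDiffAt_const
  · exact h.contDiffAt_frameMetric k l

variable {V : Type*} [AddCommGroup V] [Module ℝ V]

/-- The components of a three-form in the frame `e₁, …, e₇` of `V` defined by an isomorphism
`e : ℝ⁷ → V`. -/
noncomputable def formComponents (φ : V [⋀^Fin 3]→ₗ[ℝ] ℝ) (e : EuclideanSpace ℝ (Fin 7) → V)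
    (i j k : Fin 7) : ℝ :=
  φ ![e (EuclideanSpace.basisFun (Fin 7) ℝ i), e (EuclideanSpace.basisFun (Fin 7) ℝ j),
    e (EuclideanSpace.basisFun (Fin 7) ℝ k)]

variable {φ : V [⋀^Fin 3]→ₗ[ℝ] ℝ} {f : EuclideanSpace ℝ (Fin 7) ≃ₗ[ℝ] V}

theorem apply_eq_phiZero (hf : φ.compLinearMap (f : EuclideanSpace ℝ (Fin 7) →ₗ[ℝ] V) = phiZero)
    (x y z : V) : φ ![x, y, z] = phiZero ![f.symm x, f.symm y, f.symm z] := by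
  rw [← hf, AlternatingMap.compLinearMap_apply]
  congr 1
  funext i
  fin_cases i <;> simp

/-- The matrix of `f⁻¹ ∘ e`: its columns are the coordinates of the frame `e` in the frame `f`. -/
noncomputable def frameMatrix (f e : EuclideanSpace ℝ (Fin 7) ≃ₗ[ℝ] V) :
    Matrix (Fin 7) (Fin 7) ℝ :=
  of fun i j => f.symm (e (EuclideanSpace.basisFun (Fin 7) ℝ j)) i

theorem frameMatrix_mulVec (f e : EuclideanSpace ℝ (Fin 7) ≃ₗ[ℝ] V)
    (w : EuclideanSpace ℝ (Fin 7)) : frameMatrix f e *ᵥ w = f.symm (e w) := by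
  funext i
  have hw := (EuclideanSpace.basisFun (Fin 7) ℝ).sum_repr w
  conv_rhs => rw [← hw]
  simp [frameMatrix, mulVec, dotProduct, mul_comm]

theorem frameMatrix_det_ne_zero (f e : EuclideanSpace ℝ (Fin 7) ≃ₗ[ℝ] V) :
    (frameMatrix f e).det ≠ 0 := by
  intro h
  obtain ⟨v, hv, h0⟩ := exists_mulVec_eq_zero_iff.mpr h
  have h1 := frameMatrix_mulVec f e (WithLp.toLp 2 v)
  have h2 : f.symm (e (WithLp.toLp 2 v)) = 0 := by
    ext i
    exact (congrFun (h1.symm.trans h0) i)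
  rw [LinearEquiv.map_eq_zero_iff, LinearEquiv.map_eq_zero_iff] at h2
  exact hv (congrArg WithLp.ofLp h2)

theorem map_sum_first (φ : V [⋀^Fin 3]→ₗ[ℝ] ℝ) {ι : Type*} [Fintype ι] (c : ι → ℝ) (x : ι → V)
    (y z : V) : φ ![∑ i, c i • x i, y, z] = ∑ i, c i * φ ![x i, y, z] := by
  have hu : ∀ t : V, (φ.toMultilinearMap.toLinearMap ![0, y, z] 0) t = φ ![t, y, z] := by
    intro t
    refine congrArg φ ?_
    funext i
    fin_cases i <;> rfl
  simp only [← hu, map_sum, map_smul, smul_eq_mul]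

theorem map_sum_last (φ : V [⋀^Fin 3]→ₗ[ℝ] ℝ) {ι : Type*} [Fintype ι] (c : ι → ℝ) (z : ι → V)
    (x y : V) : φ ![x, y, ∑ i, c i • z i] = ∑ i, c i * φ ![x, y, z i] := by
  have hu : ∀ t : V, (φ.toMultilinearMap.toLinearMap ![x, y, 0] 2) t = φ ![x, y, t] := by
    intro t
    refine congrArg φ ?_
    funext i
    fin_cases i <;> rfl
  simp only [← hu, map_sum, map_smul, smul_eq_mul]

theorem isFrameComponents_formComponents
    (hf : φ.compLinearMap (f : EuclideanSpace ℝ (Fin 7) →ₗ[ℝ] V) = phiZero)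
    (e : EuclideanSpace ℝ (Fin 7) ≃ₗ[ℝ] V) :
    IsFrameComponents (formComponents φ e) (frameMatrix f e) := by
  refine ⟨frameMatrix_det_ne_zero f e, fun c i j => ?_⟩
  have hc : ∑ l, c l • e (EuclideanSpace.basisFun (Fin 7) ℝ l) = e (WithLp.toLp 2 c) := by
    conv_rhs => rw [← (EuclideanSpace.basisFun (Fin 7) ℝ).sum_repr (WithLp.toLp 2 c)]
    simp
  have hl := map_sum_first φ c (fun l => e (EuclideanSpace.basisFun (Fin 7) ℝ l))
    (e (EuclideanSpace.basisFun (Fin 7) ℝ i)) (e (EuclideanSpace.basisFun (Fin 7) ℝ j))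
  rw [hc, apply_eq_phiZero hf, phiZero_apply, ← frameMatrix_mulVec f e (WithLp.toLp 2 c)] at hl
  refine hl.symm.trans ?_
  rw [Matrix.mul_assoc]
  rfl

theorem inner_eq_sum_frameMetric
    (hf : φ.compLinearMap (f : EuclideanSpace ℝ (Fin 7) →ₗ[ℝ] V) = phiZero)
    (e : EuclideanSpace ℝ (Fin 7) ≃ₗ[ℝ] V) (x y : EuclideanSpace ℝ (Fin 7)) :
    inner ℝ (f.symm (e x)) (f.symm (e y)) =
      ∑ i, ∑ j, x i * y j * frameMetric (formComponents φ e) i j := by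
  have h1 : inner ℝ (f.symm (e x)) (f.symm (e y)) =
      (frameMatrix f e *ᵥ x) ⬝ᵥ (frameMatrix f e *ᵥ y) := by
    rw [frameMatrix_mulVec, frameMatrix_mulVec, dotProduct_comm]
    rfl
  rw [h1, (isFrameComponents_formComponents hf e).frameMetric_eq, dotProduct_comm,
    dotProduct_mulVec, ← mulVec_transpose, mulVec_mulVec, dotProduct_comm]
  simp only [dotProduct, mulVec, Finset.mul_sum]
  exact Finset.sum_congr rfl fun i _ => Finset.sum_congr rfl fun j _ => by ring

theorem chiZero_eq_sum_frameMetric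
    (hf : φ.compLinearMap (f : EuclideanSpace ℝ (Fin 7) →ₗ[ℝ] V) = phiZero)
    (e : EuclideanSpace ℝ (Fin 7) ≃ₗ[ℝ] V) (x y z w : EuclideanSpace ℝ (Fin 7)) :
    chiZero ![f.symm (e x), f.symm (e y), f.symm (e z), f.symm (e w)] =
      (∑ p, ∑ q, (frameMetric (formComponents φ e))⁻¹ p q *
        φ ![e x, e y, e (EuclideanSpace.basisFun (Fin 7) ℝ p)] *
        φ ![e z, e w, e (EuclideanSpace.basisFun (Fin 7) ℝ q)])
        - (∑ i, ∑ j, x i * z j * frameMetric (formComponents φ e) i j) *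
          (∑ i, ∑ j, y i * w j * frameMetric (formComponents φ e) i j)
        + (∑ i, ∑ j, x i * w j * frameMetric (formComponents φ e) i j) *
          (∑ i, ∑ j, y i * z j * frameMetric (formComponents φ e) i j) := by
  rw [chiZero_apply, inner_eq_sum_frameMetric hf, inner_eq_sum_frameMetric hf,
    inner_eq_sum_frameMetric hf, inner_eq_sum_frameMetric hf]
  congr 2
  rw [(isFrameComponents_formComponents hf e).frameMetric_eq]
  set P := frameMatrix f e with hPdef
  have hu : IsUnit P.det := (frameMatrix_det_ne_zero f e).isUnit
  set m : Fin 7 → ℝ := fun p =>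
    phiZero ![f.symm (e x), f.symm (e y), EuclideanSpace.basisFun (Fin 7) ℝ p] with hm
  set n : Fin 7 → ℝ := fun p =>
    phiZero ![f.symm (e z), f.symm (e w), EuclideanSpace.basisFun (Fin 7) ℝ p] with hn
  have hlin : ∀ (a b : EuclideanSpace ℝ (Fin 7)) (p : Fin 7),
      φ ![e a, e b, e (EuclideanSpace.basisFun (Fin 7) ℝ p)] =
      (Pᵀ *ᵥ fun k =>
        phiZero ![f.symm (e a), f.symm (e b), EuclideanSpace.basisFun (Fin 7) ℝ k]) p := by
    intro a b p
    have hp : f.symm (e (EuclideanSpace.basisFun (Fin 7) ℝ p)) =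
        ∑ k, P k p • EuclideanSpace.basisFun (Fin 7) ℝ k :=
      ((EuclideanSpace.basisFun (Fin 7) ℝ).sum_repr _).symm
    rw [apply_eq_phiZero hf, hp, map_sum_last]
    rfl
  have h1 : ∀ p q, (Pᵀ * P)⁻¹ p q * φ ![e x, e y, e (EuclideanSpace.basisFun (Fin 7) ℝ p)] *
        φ ![e z, e w, e (EuclideanSpace.basisFun (Fin 7) ℝ q)] =
      (Pᵀ *ᵥ m) p * ((Pᵀ * P)⁻¹ p q * (Pᵀ *ᵥ n) q) := by
    intro p q
    rw [hlin, hlin]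
    ring
  simp only [h1, ← Finset.mul_sum]
  change m ⬝ᵥ n = (Pᵀ *ᵥ m) ⬝ᵥ ((Pᵀ * P)⁻¹ *ᵥ (Pᵀ *ᵥ n))
  rw [dotProduct_comm, mulVec_transpose P m, ← dotProduct_mulVec, mulVec_mulVec, mulVec_mulVec,
    Matrix.mul_inv_rev, ← Matrix.mul_assoc,
    mul_nonsing_inv _ hu, Matrix.one_mul, nonsing_inv_mul _ (by simpa using hu),
    one_mulVec, dotProduct_comm]
end

/-! ### Riemannian metrics from frames -/

section
variable {n : ℕ} {M : Type*} [TopologicalSpace M]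
  [ChartedSpace (EuclideanSpace ℝ (Fin n)) M]

instance (x : M) : FiniteDimensional ℝ (TangentSpace (𝓡 n) x) :=
  inferInstanceAs (FiniteDimensional ℝ (EuclideanSpace ℝ (Fin n)))

instance (x : M) : T2Space (TangentSpace (𝓡 n) x) :=
  inferInstanceAs (T2Space (EuclideanSpace ℝ (Fin n)))

/-- The inner product on a tangent space for which the isomorphism `F` is isometric. -/
noncomputable def frameInner (x : M) (F : EuclideanSpace ℝ (Fin n) ≃ₗ[ℝ] TangentSpace (𝓡 n) x) :
    TangentSpace (𝓡 n) x →L[ℝ] TangentSpace (𝓡 n) x →L[ℝ] ℝ :=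
  ((ContinuousLinearMap.precomp ℝ (LinearMap.toContinuousLinearMap F.symm.toLinearMap)) ∘L
    innerSL ℝ) ∘L (LinearMap.toContinuousLinearMap F.symm.toLinearMap)

theorem frameInner_apply (x : M) (F : EuclideanSpace ℝ (Fin n) ≃ₗ[ℝ] TangentSpace (𝓡 n) x)
    (u w : TangentSpace (𝓡 n) x) : frameInner x F u w = inner ℝ (F.symm u) (F.symm w) := rfl

variable [IsManifold (𝓡 n) ∞ M]

/-- A family of bilinear forms on the tangent spaces is smooth as soon as its components in
coordinate frames are. -/
theorem contMDiff_bilinear_of_components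
    (B : ∀ x : M, TangentSpace (𝓡 n) x →L[ℝ] TangentSpace (𝓡 n) x →L[ℝ] ℝ)
    (h : ∀ (x₀ : M) (u w : EuclideanSpace ℝ (Fin n)), ContMDiffAt (𝓡 n) 𝓘(ℝ, ℝ) ∞
      (fun x => B x ((tangentTriv n x₀).symm x u) ((tangentTriv n x₀).symm x w)) x₀) :
    ContMDiff (𝓡 n)
      ((𝓡 n).prod 𝓘(ℝ, EuclideanSpace ℝ (Fin n) →L[ℝ] EuclideanSpace ℝ (Fin n) →L[ℝ] ℝ)) ∞
      (fun x => Bundle.TotalSpace.mk'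
        (EuclideanSpace ℝ (Fin n) →L[ℝ] EuclideanSpace ℝ (Fin n) →L[ℝ] ℝ)
        (E := fun x : M => TangentSpace (𝓡 n) x →L[ℝ] TangentSpace (𝓡 n) x →L[ℝ] ℝ) x (B x)) := by
  intro x₀
  rw [contMDiffAt_hom_bundle]
  refine ⟨contMDiffAt_id, ?_⟩
  let b := EuclideanSpace.basisFun (Fin n) ℝ
  let P : Fin n → EuclideanSpace ℝ (Fin n) →L[ℝ] ℝ := fun i => EuclideanSpace.proj i
  have hsum : ContMDiffAt (𝓡 n)
      𝓘(ℝ, EuclideanSpace ℝ (Fin n) →L[ℝ] EuclideanSpace ℝ (Fin n) →L[ℝ] ℝ) ∞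
      (fun x => ∑ i, ∑ j, B x ((tangentTriv n x₀).symm x (b i)) ((tangentTriv n x₀).symm x (b j)) •
        (P i).smulRight (P j)) x₀ := by
    refine contMDiffAt_finsetSum fun i _ => contMDiffAt_finsetSum fun j _ => ?_
    exact (h x₀ (b i) (b j)).smul contMDiffAt_const
  refine hsum.congr_of_eventuallyEq ?_
  filter_upwards [(tangentTriv n x₀).open_baseSet.mem_nhds
    (FiberBundle.mem_baseSet_trivializationAt' x₀)] with x hx
  ext u w
  have hu : ∀ u, (tangentTriv n x₀).symm x u = ∑ i, u i • (tangentTriv n x₀).symm x (b i) := by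
    intro u
    have h1 := congrArg ((tangentTriv n x₀).symmL ℝ x) (b.sum_repr u)
    simp only [map_sum, map_smul] at h1
    simp only [(tangentTriv n x₀).symmL_apply hx] at h1
    exact h1.symm
  have hl : ∀ r : ℝ, (trivializationAt ℝ (fun _ : M => ℝ) x₀).linearMapAt ℝ x r = r := by
    intro r
    simp
  rw [inCoordinates_apply_eq₂ hx hx (by simp), hl, hu u, hu w]
  simp only [map_sum, map_smul, sum_apply, smul_apply,
    ContinuousLinearMap.smulRight_apply, smul_eq_mul, Finset.mul_sum]
  rw [Finset.sum_comm]
  refine Finset.sum_congr rfl fun i _ => Finset.sum_congr rfl fun j _ => ?_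
  have hP : ∀ i u, P i u = u i := fun _ _ => rfl
  rw [hP, hP]
  ring

/-- The Riemannian metric for which given isomorphisms `ℝⁿ → T_xM` are isometries. -/
noncomputable def SmoothMetric.ofFrames
    (F : ∀ x : M, EuclideanSpace ℝ (Fin n) ≃ₗ[ℝ] TangentSpace (𝓡 n) x)
    (h : ∀ (x₀ : M) (u w : EuclideanSpace ℝ (Fin n)), ContMDiffAt (𝓡 n) 𝓘(ℝ, ℝ) ∞
      (fun x => (inner ℝ ((F x).symm ((tangentTriv n x₀).symm x u))
        ((F x).symm ((tangentTriv n x₀).symm x w)) : ℝ)) x₀) : SmoothMetric n M where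
  inner x := frameInner x (F x)
  symm x u w := by rw [frameInner_apply, frameInner_apply, real_inner_comm]
  pos x u hu := by
    rw [frameInner_apply]
    exact real_inner_self_pos.mpr (by simpa using hu)
  isVonNBounded x := by
    have h1 := (NormedSpace.isVonNBounded_ball ℝ (EuclideanSpace ℝ (Fin n)) 1).image
      (LinearMap.toContinuousLinearMap (F x).toLinearMap)
    refine Bornology.IsVonNBounded.subset ?_ h1
    intro u hu
    have h2 : inner ℝ ((F x).symm u) ((F x).symm u) < 1 := hu
    refine ⟨(F x).symm u, ?_, (F x).apply_symm_apply u⟩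
    rw [real_inner_self_eq_norm_sq] at h2
    rw [mem_ball_zero_iff]
    nlinarith [norm_nonneg ((F x).symm u)]
  contMDiff := contMDiff_bilinear_of_components _ h

theorem SmoothMetric.innerAt_ofFrames
    (F : ∀ x : M, EuclideanSpace ℝ (Fin n) ≃ₗ[ℝ] TangentSpace (𝓡 n) x) (h) (x : M)
    (u w : TangentSpace (𝓡 n) x) :
    (SmoothMetric.ofFrames F h).innerAt x u w = inner ℝ ((F x).symm u) ((F x).symm w) := rfl
end

/-! ### The metric and the dual four-form of a topological `G₂`-structure -/

section
variable {N : Type*} [TopologicalSpace N] [ChartedSpace (EuclideanSpace ℝ (Fin 7)) N]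
  [IsManifold (𝓡 7) ∞ N]

theorem comp_vecCons_three {α β : Type*} (g : α → β) (x y z : α) :
    (fun i => g (![x, y, z] i)) = ![g x, g y, g z] := by
  funext i; fin_cases i <;> rfl

variable (S : G2Structure N)

theorem G2Structure.contMDiffAt_formComponents (x₀ : N) :
    ContMDiffAt (𝓡 7) 𝓘(ℝ, Fin 7 → Fin 7 → Fin 7 → ℝ) ∞
      (fun x => formComponents (S.form x) ((tangentTriv 7 x₀).symm x)) x₀ := by
  refine contMDiffAt_pi_space.mpr fun i => contMDiffAt_pi_space.mpr fun j =>
    contMDiffAt_pi_space.mpr fun k => ?_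
  have h := S.smooth x₀ ![EuclideanSpace.basisFun (Fin 7) ℝ i, EuclideanSpace.basisFun (Fin 7) ℝ j,
    EuclideanSpace.basisFun (Fin 7) ℝ k]
  simp only [comp_vecCons_three] at h
  exact h

variable {S} {f : ∀ x, EuclideanSpace ℝ (Fin 7) ≃ₗ[ℝ] TangentSpace (𝓡 7) x}
  (hf : ∀ x, IsG2Frame (S.orientation.at' x) (S.form x) (f x))

include hf

theorem G2Structure.contMDiffAt_frameMetric (x₀ : N) (i j : Fin 7) :
    ContMDiffAt (𝓡 7) 𝓘(ℝ, ℝ) ∞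
      (fun x => frameMetric (formComponents (S.form x) ((tangentTriv 7 x₀).symm x)) i j) x₀ := by
  have hx := FiberBundle.mem_baseSet_trivializationAt' (F := EuclideanSpace ℝ (Fin 7))
    (E := (TangentSpace (𝓡 7) : N → Type _)) x₀
  have h := isFrameComponents_formComponents (hf x₀).2
    ((tangentTriv 7 x₀).linearEquivAt ℝ x₀ hx).symm
  exact (h.contDiffAt_frameMetric i j).contMDiffAt.comp x₀ (S.contMDiffAt_formComponents x₀)

theorem G2Structure.contMDiffAt_frameMetric_inv (x₀ : N) (i j : Fin 7) :
    ContMDiffAt (𝓡 7) 𝓘(ℝ, ℝ) ∞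
      (fun x => (frameMetric (formComponents (S.form x) ((tangentTriv 7 x₀).symm x)))⁻¹ i j)
      x₀ := by
  have hx := FiberBundle.mem_baseSet_trivializationAt' (F := EuclideanSpace ℝ (Fin 7))
    (E := (TangentSpace (𝓡 7) : N → Type _)) x₀
  have h := isFrameComponents_formComponents (hf x₀).2
    ((tangentTriv 7 x₀).linearEquivAt ℝ x₀ hx).symm
  exact (h.contDiffAt_frameMetric_inv i j).contMDiffAt.comp x₀ (S.contMDiffAt_formComponents x₀)

theorem G2Structure.contMDiffAt_sum_frameMetric (x₀ : N) (u w : EuclideanSpace ℝ (Fin 7)) :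
    ContMDiffAt (𝓡 7) 𝓘(ℝ, ℝ) ∞ (fun x => ∑ i, ∑ j, u i * w j *
      frameMetric (formComponents (S.form x) ((tangentTriv 7 x₀).symm x)) i j) x₀ :=
  contMDiffAt_finsetSum fun i _ => contMDiffAt_finsetSum fun j _ =>
    contMDiffAt_const.mul (contMDiffAt_frameMetric hf x₀ i j)

/-- The inner product for which arbitrarily chosen `G₂`-frames are isometries is smooth, although
the frames themselves need not depend continuously on the point. -/
theorem G2Structure.contMDiffAt_inner (x₀ : N) (u w : EuclideanSpace ℝ (Fin 7)) :
    ContMDiffAt (𝓡 7) 𝓘(ℝ, ℝ) ∞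
      (fun x => (inner ℝ ((f x).symm ((tangentTriv 7 x₀).symm x u))
        ((f x).symm ((tangentTriv 7 x₀).symm x w)) : ℝ)) x₀ := by
  refine (contMDiffAt_sum_frameMetric hf x₀ u w).congr_of_eventuallyEq ?_
  filter_upwards [(tangentTriv 7 x₀).open_baseSet.mem_nhds
    (FiberBundle.mem_baseSet_trivializationAt' x₀)] with x hx
  exact inner_eq_sum_frameMetric (hf x).2 ((tangentTriv 7 x₀).linearEquivAt ℝ x hx).symm u w

/-- The Hodge dual of the three-form of a topological `G₂`-structure is smooth. -/
theorem G2Structure.isSmoothForm_chi :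
    IsSmoothForm (n := 7) (k := 4) (M := N)
      (fun x => chiZero.compLinearMap ((f x).symm : TangentSpace (𝓡 7) x →ₗ[ℝ] _)) := by
  intro x₀ w
  have hm : ∀ (u v : EuclideanSpace ℝ (Fin 7)) (p : Fin 7), ContMDiffAt (𝓡 7) 𝓘(ℝ, ℝ) ∞
      (fun x => S.form x ![(tangentTriv 7 x₀).symm x u, (tangentTriv 7 x₀).symm x v,
        (tangentTriv 7 x₀).symm x (EuclideanSpace.basisFun (Fin 7) ℝ p)]) x₀ := by
    intro u v p
    have h := S.smooth x₀ ![u, v, EuclideanSpace.basisFun (Fin 7) ℝ p]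
    simp only [comp_vecCons_three] at h
    exact h
  have hg := contMDiffAt_sum_frameMetric hf x₀
  have h : ContMDiffAt (𝓡 7) 𝓘(ℝ, ℝ) ∞ _ x₀ :=
    ((contMDiffAt_finsetSum (t := Finset.univ) fun p _ =>
      contMDiffAt_finsetSum (t := Finset.univ) fun q _ =>
      ((contMDiffAt_frameMetric_inv hf x₀ p q).mul (hm (w 0) (w 1) p)).mul (hm (w 2) (w 3) q)).sub
    ((hg (w 0) (w 2)).mul (hg (w 1) (w 3)))).add ((hg (w 0) (w 3)).mul (hg (w 1) (w 2)))
  refine h.congr_of_eventuallyEq ?_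
  filter_upwards [(tangentTriv 7 x₀).open_baseSet.mem_nhds
    (FiberBundle.mem_baseSet_trivializationAt' x₀)] with x hx
  refine Eq.trans ?_ (chiZero_eq_sum_frameMetric (hf x).2
    ((tangentTriv 7 x₀).linearEquivAt ℝ x hx).symm (w 0) (w 1) (w 2) (w 3))
  rw [AlternatingMap.compLinearMap_apply]
  refine congrArg chiZero ?_
  funext i
  fin_cases i <;> rfl

theorem G2Structure.exists_induces :
    ∃ g : SmoothMetric 7 N, S.Induces g ∧
      ∀ x u w, g.innerAt x u w = inner ℝ ((f x).symm u) ((f x).symm w) := by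
  refine ⟨SmoothMetric.ofFrames f (contMDiffAt_inner hf), fun x => ⟨f x, hf x, fun u w => ?_⟩,
    fun x u w => rfl⟩
  rw [SmoothMetric.innerAt_ofFrames, LinearEquiv.symm_apply_apply, LinearEquiv.symm_apply_apply]
end

/-! ### Pullbacks of forms and metrics -/

section
variable {m n : ℕ} {M N : Type*} [TopologicalSpace M] [ChartedSpace (EuclideanSpace ℝ (Fin m)) M]
  [IsManifold (𝓡 m) ∞ M] [TopologicalSpace N] [ChartedSpace (EuclideanSpace ℝ (Fin n)) N]
  [IsManifold (𝓡 n) ∞ N]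

/-- The differential of `F` in the coordinates of charts around `x₀` and `F x₀`. -/
noncomputable def mfderivCoord (n : ℕ) [ChartedSpace (EuclideanSpace ℝ (Fin n)) N]
    [IsManifold (𝓡 n) ∞ N] (F : M → N) (x₀ x : M) (u : EuclideanSpace ℝ (Fin m)) :
    EuclideanSpace ℝ (Fin n) :=
  inTangentCoordinates (𝓡 m) (𝓡 n) id F (mfderiv (𝓡 m) (𝓡 n) F) x₀ x u

theorem contMDiffAt_mfderivCoord {F : M → N} (hF : ContMDiff (𝓡 m) (𝓡 n) ∞ F) (x₀ : M)
    (u : EuclideanSpace ℝ (Fin m)) :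
    ContMDiffAt (𝓡 m) 𝓘(ℝ, EuclideanSpace ℝ (Fin n)) ∞ (fun x => mfderivCoord n F x₀ x u) x₀ :=
  ((hF x₀).mfderiv_const (m := ∞) le_rfl).clm_apply contMDiffAt_const

theorem contMDiffAt_mfderivCoord_apply {F : M → N} (hF : ContMDiff (𝓡 m) (𝓡 n) ∞ F) (x₀ : M)
    (u : EuclideanSpace ℝ (Fin m)) (j : Fin n) :
    ContMDiffAt (𝓡 m) 𝓘(ℝ, ℝ) ∞ (fun x => mfderivCoord n F x₀ x u j) x₀ := by
  have h := (EuclideanSpace.proj j : EuclideanSpace ℝ (Fin n) →L[ℝ] ℝ).contDiff (n := ∞)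
  exact h.contMDiff.contMDiffAt.comp x₀ (contMDiffAt_mfderivCoord hF x₀ u)

theorem eventually_mem_baseSet (x₀ : M) : ∀ᶠ x in 𝓝 x₀, x ∈ (tangentTriv m x₀).baseSet :=
  (tangentTriv m x₀).open_baseSet.mem_nhds (FiberBundle.mem_baseSet_trivializationAt' x₀)

theorem tangentTriv_symm_eq_sum {x₀ x : M} (hx : x ∈ (tangentTriv m x₀).baseSet)
    (u : EuclideanSpace ℝ (Fin m)) :
    (tangentTriv m x₀).symm x u =
      ∑ i, u i • (tangentTriv m x₀).symm x (EuclideanSpace.basisFun (Fin m) ℝ i) := by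
  have h1 := congrArg ((tangentTriv m x₀).symmL ℝ x)
    ((EuclideanSpace.basisFun (Fin m) ℝ).sum_repr u)
  simp only [map_sum, map_smul] at h1
  simp only [(tangentTriv m x₀).symmL_apply hx] at h1
  exact h1.symm

theorem mfderiv_tangentTriv_symm {F : M → N} {x₀ x : M} (hx : x ∈ (tangentTriv m x₀).baseSet)
    (hy : F x ∈ (tangentTriv n (F x₀)).baseSet) (u : EuclideanSpace ℝ (Fin m)) :
    mfderiv (𝓡 m) (𝓡 n) F x ((tangentTriv m x₀).symm x u) =
      (tangentTriv n (F x₀)).symm (F x) (mfderivCoord n F x₀ x u) := by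
  have h : mfderivCoord n F x₀ x u = (tangentTriv n (F x₀)).linearEquivAt ℝ (F x) hy
      (mfderiv (𝓡 m) (𝓡 n) F x ((tangentTriv m x₀).symm x u)) := by
    have h2 := ContinuousLinearMap.inCoordinates_eq (σ := RingHom.id ℝ)
      (ϕ := mfderiv (𝓡 m) (𝓡 n) F x) hx hy
    exact congrArg (fun L => L u) h2
  rw [h]
  exact (((tangentTriv n (F x₀)).linearEquivAt ℝ (F x) hy).symm_apply_apply _).symm

theorem IsSmoothForm.pullbackForm {F : M → N} (hF : ContMDiff (𝓡 m) (𝓡 n) ∞ F) {k : ℕ}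
    {α : FormField n k N} (hα : IsSmoothForm α) : IsSmoothForm (pullbackForm (m := m) F α) := by
  intro x₀ w
  have h : ContMDiffAt (𝓡 m) 𝓘(ℝ, ℝ) ∞ (fun x => ∑ J : Fin k → Fin n,
      (∏ i, mfderivCoord n F x₀ x (w i) (J i)) * α (F x) fun i =>
        (tangentTriv n (F x₀)).symm (F x) (EuclideanSpace.basisFun (Fin n) ℝ (J i))) x₀ := by
    refine contMDiffAt_finsetSum fun J _ => ContMDiffAt.mul
      (contMDiffAt_finsetProd fun i _ => contMDiffAt_mfderivCoord_apply hF x₀ _ _) ?_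
    exact (hα (F x₀) fun i => EuclideanSpace.basisFun (Fin n) ℝ (J i)).comp x₀ (hF x₀)
  refine h.congr_of_eventuallyEq ?_
  filter_upwards [eventually_mem_baseSet (m := m) x₀,
    hF.continuous.continuousAt.eventually (eventually_mem_baseSet (m := n) (F x₀))] with x hx hy
  change α (F x) (fun i => mfderiv (𝓡 m) (𝓡 n) F x ((tangentTriv m x₀).symm x (w i))) = _
  simp only [mfderiv_tangentTriv_symm hx hy, tangentTriv_symm_eq_sum hy (mfderivCoord _ _ _ _ _)]
  refine ((α (F x)).toMultilinearMap.map_sum _).trans (Finset.sum_congr rfl fun J _ => ?_)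
  exact (α (F x)).toMultilinearMap.map_smul_univ _ _

theorem SmoothMetric.contMDiffAt_innerAt (g : SmoothMetric n N) (x₀ : N)
    (u w : EuclideanSpace ℝ (Fin n)) : ContMDiffAt (𝓡 n) 𝓘(ℝ, ℝ) ∞
      (fun x => g.innerAt x ((tangentTriv n x₀).symm x u) ((tangentTriv n x₀).symm x w)) x₀ := by
  have h := ((contMDiffAt_hom_bundle _).mp (g.contMDiff x₀)).2
  have h2 := (h.clm_apply (contMDiffAt_const (c := u))).clm_apply (contMDiffAt_const (c := w))
  refine h2.congr_of_eventuallyEq ?_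
  filter_upwards [eventually_mem_baseSet (m := n) x₀] with x hx
  have hl : ∀ r : ℝ, (trivializationAt ℝ (fun _ : N => ℝ) x₀).linearMapAt ℝ x r = r := by
    intro r
    simp
  rw [inCoordinates_apply_eq₂ hx hx (by simp), hl]
  rfl

theorem SmoothMetric.contMDiffAt_innerAt_mfderiv (g : SmoothMetric n N) {F : M → N}
    (hF : ContMDiff (𝓡 m) (𝓡 n) ∞ F) (x₀ : M)
    (u w : EuclideanSpace ℝ (Fin m)) : ContMDiffAt (𝓡 m) 𝓘(ℝ, ℝ) ∞
      (fun x => g.innerAt (F x) (mfderiv (𝓡 m) (𝓡 n) F x ((tangentTriv m x₀).symm x u))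
        (mfderiv (𝓡 m) (𝓡 n) F x ((tangentTriv m x₀).symm x w))) x₀ := by
  have h : ContMDiffAt (𝓡 m) 𝓘(ℝ, ℝ) ∞ (fun x => ∑ i, ∑ j,
      mfderivCoord n F x₀ x u i * (mfderivCoord n F x₀ x w j * g.innerAt (F x)
        ((tangentTriv n (F x₀)).symm (F x) (EuclideanSpace.basisFun (Fin n) ℝ i))
        ((tangentTriv n (F x₀)).symm (F x) (EuclideanSpace.basisFun (Fin n) ℝ j)))) x₀ := by
    refine contMDiffAt_finsetSum fun i _ => contMDiffAt_finsetSum fun j _ =>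
      (contMDiffAt_mfderivCoord_apply hF x₀ _ _).mul
        ((contMDiffAt_mfderivCoord_apply hF x₀ _ _).mul ?_)
    exact (g.contMDiffAt_innerAt (F x₀) _ _).comp x₀ (hF x₀)
  refine h.congr_of_eventuallyEq ?_
  filter_upwards [eventually_mem_baseSet (m := m) x₀,
    hF.continuous.continuousAt.eventually (eventually_mem_baseSet (m := n) (F x₀))] with x hx hy
  simp only [mfderiv_tangentTriv_symm hx hy, tangentTriv_symm_eq_sum hy (mfderivCoord _ _ _ _ _),
    SmoothMetric.innerAt, map_sum, map_smul, sum_apply, smul_apply, smul_eq_mul, Finset.mul_sum]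
  rw [Finset.sum_comm]
  refine Finset.sum_congr rfl fun i _ => Finset.sum_congr rfl fun j _ => ?_
  ring
end

/-! ### Integrals depending smoothly on a parameter -/

section
open MeasureTheory Set

/-- Smooth dependence of an integral on parameters. The integral is the convolution, evaluated at
`0`, of the indicator function of `(a, b]` with `k` cut off by a bump function and reflected. -/
theorem contDiffOn_intervalIntegral_param {E F : Type*} [NormedAddCommGroup E] [NormedSpace ℝ E]
    [NormedAddCommGroup F] [NormedSpace ℝ F] {k : E → ℝ → F} {s : Set E} (hs : IsOpen s)
    (hk : ContDiffOn ℝ ∞ (fun p : E × ℝ => k p.1 p.2) (s ×ˢ univ)) {a b : ℝ} (hab : a ≤ b) :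
    ContDiffOn ℝ ∞ (fun p => ∫ t in a..b, k p t) s := by
  let χ : ContDiffBump (0 : ℝ) := ⟨|a| + |b| + 1, |a| + |b| + 2, by positivity, by linarith⟩
  have hχ1 : ∀ t ∈ Ioc a b, χ t = 1 := by
    intro t ht
    refine χ.one_of_mem_closedBall ?_
    rw [mem_closedBall_zero_iff, Real.norm_eq_abs]
    change |t| ≤ |a| + |b| + 1
    have h1 := neg_abs_le a
    have h2 := le_abs_self b
    have h3 := abs_nonneg a
    have h4 := abs_nonneg b
    exact abs_le.mpr ⟨by linarith [ht.1], by linarith [ht.2]⟩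
  have h := contDiffOn_convolution_right_with_param (𝕜 := ℝ) (μ := volume) (n := ⊤)
    (f := indicator (Ioc a b) (fun _ => (1 : ℝ))) (g := fun p x => χ (-x) • k p (-x))
    (ContinuousLinearMap.lsmul ℝ ℝ) hs (isCompact_closedBall (0 : ℝ) (|a| + |b| + 2))
    (fun p x _ hx => ?_) ?_ ?_
  · have h0 : ContDiffOn ℝ ∞ (fun p : E => (p, (0 : ℝ))) s :=
      (contDiff_id.prodMk contDiff_const).contDiffOn
    refine (h.comp h0 fun p hp => ⟨hp, mem_univ _⟩).congr fun p hp => ?_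
    rw [intervalIntegral.integral_of_le hab, Function.comp_apply, convolution_def,
      ← integral_indicator measurableSet_Ioc]
    refine integral_congr_ae (Filter.Eventually.of_forall fun t => ?_)
    by_cases ht : t ∈ Ioc a b
    · simp [ht, hχ1 t ht]
    · simp [ht]
  · rw [χ.zero_of_le_dist, zero_smul]
    rw [mem_closedBall_zero_iff, not_le] at hx
    simpa using hx.le
  · exact ((integrable_indicator_iff measurableSet_Ioc).mpr
      (integrableOn_const (by simp) (by simp))).locallyIntegrable
  · have hneg : ContDiffOn ℝ ∞ (fun p : E × ℝ => (p.1, -p.2)) (s ×ˢ univ) := by fun_prop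
    refine ContDiffOn.smul (χ.contDiff.comp (contDiff_snd.neg)).contDiffOn
      (hk.comp hneg fun p hp => ⟨hp.1, mem_univ _⟩)

theorem contMDiff_intervalIntegral_param {n : ℕ} {M F : Type*} [TopologicalSpace M]
    [ChartedSpace (EuclideanSpace ℝ (Fin n)) M] [IsManifold (𝓡 n) ∞ M]
    [NormedAddCommGroup F] [NormedSpace ℝ F] {k : M → ℝ → F}
    (hk : ContMDiff ((𝓡 n).prod 𝓘(ℝ, ℝ)) 𝓘(ℝ, F) ∞ (fun p : M × ℝ => k p.1 p.2))
    {a b : ℝ} (hab : a ≤ b) :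
    ContMDiff (𝓡 n) 𝓘(ℝ, F) ∞ (fun q => ∫ t in a..b, k q t) := by
  intro q₀
  set e := chartAt (EuclideanSpace ℝ (Fin n)) q₀ with he
  have h1 : ContMDiffOn (𝓡 n) (𝓡 n) ∞ e.symm e.target := contMDiffOn_chart_symm
  have h2 : ContMDiffOn ((𝓡 n).prod 𝓘(ℝ, ℝ)) ((𝓡 n).prod 𝓘(ℝ, ℝ)) ∞
      (fun p : EuclideanSpace ℝ (Fin n) × ℝ => (e.symm p.1, p.2)) (e.target ×ˢ univ) :=
    (h1.comp contMDiffOn_fst fun p hp => hp.1).prodMk contMDiffOn_snd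
  have h3 := hk.comp_contMDiffOn h2
  rw [← modelWithCornersSelf_prod, chartedSpaceSelf_prod, contMDiffOn_iff_contDiffOn] at h3
  have h4 := contDiffOn_intervalIntegral_param (k := fun y t => k (e.symm y) t) e.open_target h3 hab
  have h5 : ContMDiffAt (𝓡 n) (𝓡 n) ∞ e q₀ :=
    (contMDiffOn_chart (I := 𝓡 n)).contMDiffAt (e.open_source.mem_nhds (mem_chart_source _ q₀))
  have h6 := (h4.contMDiffOn.contMDiffAt
    (e.open_target.mem_nhds (mem_chart_target _ q₀))).comp q₀ h5
  refine h6.congr_of_eventuallyEq ?_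
  filter_upwards [e.open_source.mem_nhds (mem_chart_source _ q₀)] with q hq
  rw [Function.comp_apply, ← he, e.left_inv hq]
end

/-! ### Equivariant functions -/

section
open MeasureTheory Set
variable {n : ℕ} {M : Type*} [MulAction Circle M]

/-- The average `q ↦ ∫ e^{-it} ρ(e^{it} q) dt`, which is an equivariant complex function. -/
noncomputable def circleAverage (ρ : M → ℝ) (q : M) : ℂ :=
  ∫ t in -Real.pi..Real.pi, (ρ (Circle.exp t • q) : ℂ) * (Circle.exp (-t) : ℂ)

theorem circleAverage_smul (ρ : M → ℝ) (z : Circle) (q : M) :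
    circleAverage ρ (z • q) = (z : ℂ) * circleAverage ρ q := by
  obtain ⟨s, rfl⟩ := Circle.exp_surjective z
  have hper : Function.Periodic
      (fun t : ℝ => (ρ (Circle.exp t • q) : ℂ) * (Circle.exp (-t) : ℂ)) (2 * Real.pi) := by
    intro t
    have h1 : Circle.exp (t + 2 * Real.pi) = Circle.exp t := Circle.periodic_exp t
    have h2 : Circle.exp (-(t + 2 * Real.pi)) = Circle.exp (-t) := by
      rw [Circle.exp_neg, h1, Circle.exp_neg]
    simp only [h1, h2]
  have h := hper.intervalIntegral_add_eq (-Real.pi) (-Real.pi + s)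
  rw [circleAverage, circleAverage]
  have e1 : -Real.pi + 2 * Real.pi = Real.pi := by ring
  have e2 : -Real.pi + s + 2 * Real.pi = Real.pi + s := by ring
  rw [e1, e2, ← intervalIntegral.integral_comp_add_right] at h
  rw [h, ← intervalIntegral.integral_const_mul]
  refine intervalIntegral.integral_congr fun t _ => ?_
  simp only [Circle.exp_add, neg_add, mul_smul, Circle.coe_mul, Circle.exp_neg]
  have : (Circle.exp s : ℂ) * ((Circle.exp s)⁻¹ : Circle) = 1 := by
    rw [← Circle.coe_mul, mul_inv_cancel, Circle.coe_one]
  linear_combination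
    (-(ρ (Circle.exp t • Circle.exp s • q) : ℂ) * ((Circle.exp t)⁻¹ : Circle)) * this

variable [TopologicalSpace M] [ChartedSpace (EuclideanSpace ℝ (Fin n)) M]

theorem continuous_circle_smul [ContMDiffSMul (𝓡 1) (𝓡 n) ∞ Circle M] : ContinuousSMul Circle M :=
  ContMDiffSMul.continuousSMul (I := 𝓡 1) (I' := 𝓡 n) ∞

theorem contMDiff_exp_smul [ContMDiffSMul (𝓡 1) (𝓡 n) ∞ Circle M] :
    ContMDiff ((𝓡 n).prod 𝓘(ℝ, ℝ)) (𝓡 n) ∞ (fun p : M × ℝ => Circle.exp p.2 • p.1) :=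
  (ContMDiffSMul.contMDiff_smul (I := 𝓡 1) (I' := 𝓡 n) (n := ∞) (G := Circle) (M := M)).comp
    ((contMDiff_circleExp.comp contMDiff_snd).prodMk contMDiff_fst)

theorem contMDiff_circleAverage [IsManifold (𝓡 n) ∞ M] [ContMDiffSMul (𝓡 1) (𝓡 n) ∞ Circle M]
    {ρ : M → ℝ} (hρ : ContMDiff (𝓡 n) 𝓘(ℝ, ℝ) ∞ ρ) :
    ContMDiff (𝓡 n) 𝓘(ℝ, ℂ) ∞ (circleAverage ρ) := by
  have h1 : ContMDiff ((𝓡 n).prod 𝓘(ℝ, ℝ)) 𝓘(ℝ, ℝ) ∞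
      (fun p : M × ℝ => ρ (Circle.exp p.2 • p.1)) := hρ.comp contMDiff_exp_smul
  have h2 : ContDiff ℝ ∞ (fun t : ℝ => (Circle.exp (-t) : ℂ)) := by
    simp only [Circle.coe_exp]
    exact Complex.contDiff_exp.comp
      ((Complex.ofRealCLM.contDiff.comp contDiff_neg).mul contDiff_const)
  have h3 : ContMDiff ((𝓡 n).prod 𝓘(ℝ, ℝ)) 𝓘(ℝ, ℂ) ∞
      (fun p : M × ℝ => (Circle.exp (-p.2) : ℂ)) := h2.contMDiff.comp contMDiff_snd
  have h4 : ContMDiff ((𝓡 n).prod 𝓘(ℝ, ℝ)) 𝓘(ℝ, ℂ) ∞ (fun p : M × ℝ =>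
      (ρ (Circle.exp p.2 • p.1) : ℂ) * (Circle.exp (-p.2) : ℂ)) :=
    (h1.smul h3).congr fun p => Complex.real_smul.symm
  exact contMDiff_intervalIntegral_param h4 (by linarith [Real.pi_pos])

/-- Since the action is free and `{z ∈ S¹ | Re z ≤ 0}` is compact, every point has a neighbourhood
which no `z` with `Re z ≤ 0` moves to meet itself. -/
theorem exists_open_re_pos [T2Space M] [ContMDiffSMul (𝓡 1) (𝓡 n) ∞ Circle M]
    (hfree : ∀ (z : Circle) (p : M), z • p = p → z = 1) (p : M) :
    ∃ U : Set M, IsOpen U ∧ p ∈ U ∧ ∀ (z : Circle), ∀ q ∈ U, z • q ∈ U → 0 < (z : ℂ).re := by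
  have := continuous_circle_smul (n := n) (M := M)
  have hK : IsCompact {z : Circle | (z : ℂ).re ≤ 0} :=
    (isClosed_le (by fun_prop) continuous_const).isCompact
  have hO : IsOpen {x : Circle × (M × M) | x.1 • x.2.1 ≠ x.2.2} :=
    isOpen_ne_fun (by fun_prop) (by fun_prop)
  obtain ⟨u, v, -, hv, hu', hv', huv⟩ :=
    generalized_tube_lemma hK (isCompact_singleton (x := (p, p))) hO (by
      rintro ⟨z, q⟩ ⟨hz, rfl⟩ h0
      have h1 := hfree z p h0
      simp [h1] at hz
      linarith)
  obtain ⟨a, b, ha, hb, hpa, hpb, hab⟩ := isOpen_prod_iff.mp hv p p (hv' rfl)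
  refine ⟨a ∩ b, ha.inter hb, ⟨hpa, hpb⟩, fun z q hq hzq => ?_⟩
  by_contra hz
  exact huv (show (z, (q, z • q)) ∈ u ×ˢ v from ⟨hu' (not_lt.mp hz), hab ⟨hq.1, hzq.2⟩⟩) rfl

/-- The real part of the average is the integral of `ρ(e^{it} q) cos t`. The integrand is positive at
`t = 0` and nowhere negative: `cos t > 0` whenever `q` and `e^{it} q` both lie in `U`. -/
theorem circleAverage_ne_zero [ContMDiffSMul (𝓡 1) (𝓡 n) ∞ Circle M]
    {ρ : M → ℝ} (hρ : Continuous ρ) (h0 : ∀ q, 0 ≤ ρ q) {U : Set M}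
    (hU : ∀ (z : Circle), ∀ q ∈ U, z • q ∈ U → 0 < (z : ℂ).re) (hsupp : ∀ q, ρ q ≠ 0 → q ∈ U)
    {q : M} (hq : ρ q ≠ 0) : circleAverage ρ q ≠ 0 := by
  have := continuous_circle_smul (n := n) (M := M)
  intro h
  have hre : (circleAverage ρ q).re =
      ∫ t in -Real.pi..Real.pi, ρ (Circle.exp t • q) * Real.cos t := by
    have hint : IntervalIntegrable
        (fun t : ℝ => (ρ (Circle.exp t • q) : ℂ) * (Circle.exp (-t) : ℂ)) volume
        (-Real.pi) Real.pi := by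
      refine Continuous.intervalIntegrable ?_ _ _
      fun_prop
    refine (Complex.reCLM.intervalIntegral_comp_comm hint).symm.trans ?_
    refine intervalIntegral.integral_congr fun t _ => ?_
    have hexp : (Circle.exp (-t) : ℂ).re = Real.cos t := by
      rw [Circle.coe_exp, Complex.exp_ofReal_mul_I_re, Real.cos_neg]
    simp only [Complex.reCLM_apply, Complex.re_ofReal_mul, hexp]
  have hpos : 0 < ∫ t in -Real.pi..Real.pi, ρ (Circle.exp t • q) * Real.cos t := by
    refine intervalIntegral.integral_pos (by linarith [Real.pi_pos]) (by fun_prop) ?_ ?_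
    · intro t _
      by_cases ht : ρ (Circle.exp t • q) = 0
      · simp [ht]
      · have := hU (Circle.exp t) q (hsupp q hq) (hsupp _ ht)
        have hcos : 0 < Real.cos t := by simpa [Circle.coe_exp, Complex.exp_re] using this
        exact mul_nonneg (h0 _) hcos.le
    · refine ⟨0, ⟨by linarith [Real.pi_pos], Real.pi_pos.le⟩, ?_⟩
      simpa using lt_of_le_of_ne (h0 q) hq.symm
  rw [← hre, h] at hpos
  simp at hpos

theorem circleAverage_eventually_zero [ContMDiffSMul (𝓡 1) (𝓡 n) ∞ Circle M]
    {ι : Type*} {ρ : ι → M → ℝ} (hρ : LocallyFinite fun i => Function.support (ρ i)) (p : M) :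
    ∃ s : Finset ι, ∀ᶠ q in 𝓝 p, ∀ i ∉ s, circleAverage (ρ i) q = 0 := by
  have := continuous_circle_smul (n := n) (M := M)
  have hK : IsCompact (range fun z : Circle => z • p) := isCompact_range (by fun_prop)
  have hfin := hρ.closure.finite_nonempty_inter_compact hK
  set s := hfin.toFinset
  have hcl : IsClosed (⋃ i : {i // i ∉ s}, closure (Function.support (ρ i))) :=
    (hρ.closure.comp_injective Subtype.val_injective).isClosed_iUnion fun _ => isClosed_closure
  have hO : IsOpen {x : Circle × M |
      x.1 • x.2 ∉ ⋃ i : {i // i ∉ s}, closure (Function.support (ρ i))} :=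
    hcl.isOpen_compl.preimage continuous_smul
  obtain ⟨u, v, -, hv, hu', hv', huv⟩ :=
    generalized_tube_lemma (isCompact_univ (X := Circle)) (isCompact_singleton (x := p)) hO (by
      rintro ⟨z, q⟩ ⟨-, rfl⟩ h
      obtain ⟨i, hi⟩ := mem_iUnion.mp h
      exact i.2 (hfin.mem_toFinset.mpr ⟨_, hi, z, rfl⟩))
  refine ⟨s, ?_⟩
  filter_upwards [hv.mem_nhds (hv' rfl)] with q hq i hi
  have hz : ∀ z : Circle, ρ i (z • q) = 0 := by
    intro z
    by_contra h
    exact huv (show (z, q) ∈ u ×ˢ v from ⟨hu' (mem_univ z), hq⟩)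
      (mem_iUnion.mpr ⟨⟨i, hi⟩, subset_closure h⟩)
  simp [circleAverage, hz]
end

/-! ### Differentials of equivariant functions -/

section
variable {n : ℕ} {M : Type*} [TopologicalSpace M] [ChartedSpace (EuclideanSpace ℝ (Fin n)) M]

/-- The differential of a complex function on a manifold, with values in `ℂ`. -/
noncomputable def complexDifferential (h : M → ℂ) (q : M) : TangentSpace (𝓡 n) q →L[ℝ] ℂ :=
  mfderiv (𝓡 n) 𝓘(ℝ, ℂ) h q

theorem contMDiffAt_complexDifferential [IsManifold (𝓡 n) ∞ M]
    {h : M → ℂ} (hh : ContMDiff (𝓡 n) 𝓘(ℝ, ℂ) ∞ h) (x₀ : M) (u : EuclideanSpace ℝ (Fin n)) :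
    ContMDiffAt (𝓡 n) 𝓘(ℝ, ℂ) ∞
      (fun x => complexDifferential h x ((tangentTriv n x₀).symm x u)) x₀ := by
  have h1 := ((hh x₀).mfderiv_const (m := ∞) le_rfl).clm_apply (contMDiffAt_const (c := u))
  refine h1.congr_of_eventuallyEq ?_
  filter_upwards [eventually_mem_baseSet (m := n) x₀] with x hx
  have h2 : inTangentCoordinates (𝓡 n) 𝓘(ℝ, ℂ) id h (mfderiv (𝓡 n) 𝓘(ℝ, ℂ) h) x₀ x u =
      (trivializationAt ℂ (TangentSpace 𝓘(ℝ, ℂ)) (h x₀)).continuousLinearMapAt ℝ (h x)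
        (mfderiv (𝓡 n) 𝓘(ℝ, ℂ) h x ((tangentTriv n x₀).symmL ℝ x u)) := rfl
  rw [h2, TangentBundle.continuousLinearMapAt_model_space, (tangentTriv n x₀).symmL_apply hx]
  rfl

variable [MulAction Circle M] [ContMDiffSMul (𝓡 1) (𝓡 n) ∞ Circle M]

theorem contMDiff_circle_smul (z : Circle) : ContMDiff (𝓡 n) (𝓡 n) ∞ (fun p : M => z • p) :=
  (ContMDiffSMul.contMDiff_smul (I := 𝓡 1) (I' := 𝓡 n) (n := ∞) (G := Circle) (M := M)).comp
    (contMDiff_const.prodMk contMDiff_id)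

theorem complexDifferential_smul {h : M → ℂ} (hh : ContMDiff (𝓡 n) 𝓘(ℝ, ℂ) ∞ h)
    (heq : ∀ (z : Circle) (q : M), h (z • q) = (z : ℂ) * h q) (z : Circle) (q : M)
    (u : TangentSpace (𝓡 n) q) :
    complexDifferential h (z • q) (mfderiv (𝓡 n) (𝓡 n) (fun p : M => z • p) q u) =
      (z : ℂ) * complexDifferential h q u := by
  have h1 := (hh.mdifferentiable (by simp) (z • q)).hasMFDerivAt.comp q
    ((contMDiff_circle_smul (n := n) z).mdifferentiable (by simp) q).hasMFDerivAt
  have h2 : h ∘ (fun p : M => z • p) = ContinuousLinearMap.mul ℝ ℂ (z : ℂ) ∘ h := by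
    funext p
    exact heq z p
  have h3 := (ContinuousLinearMap.mul ℝ ℂ (z : ℂ)).hasMFDerivAt.comp q
    (hh.mdifferentiable (by simp) q).hasMFDerivAt
  rw [h2] at h1
  exact congrArg (fun L => L u) (hasMFDerivAt_unique h1 h3)

theorem mdifferentiableAt_exp_smul (q : M) :
    MDifferentiableAt 𝓘(ℝ, ℝ) (𝓡 n) (fun t : ℝ => Circle.exp t • q) 0 := by
  have := (contMDiff_exp_smul (n := n) (M := M)).comp
    ((contMDiff_const (c := q)).prodMk (contMDiff_id (I := 𝓘(ℝ, ℝ)) (M := ℝ)))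
  exact this.mdifferentiable (by simp) 0

theorem complexDifferential_circleGenerator {h : M → ℂ} (hh : ContMDiff (𝓡 n) 𝓘(ℝ, ℂ) ∞ h)
    (heq : ∀ (z : Circle) (q : M), h (z • q) = (z : ℂ) * h q) (q : M) :
    complexDifferential h q (circleGenerator (n := n) q) = Complex.I * h q := by
  have hc := mdifferentiableAt_exp_smul (n := n) q
  have h0 : Circle.exp 0 • q = q := by simp
  -- `circleGenerator q` is the velocity at `exp 0 • q`, which equals `q` only propositionally.
  have hq : ∀ q' : M, q' = q → HasMFDerivAt (𝓡 n) 𝓘(ℝ, ℂ) h q'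
      (complexDifferential h q : EuclideanSpace ℝ (Fin n) →L[ℝ] ℂ) := by
    rintro _ rfl
    exact (hh.mdifferentiable (by simp) _).hasMFDerivAt
  have h1 := (hq _ h0).comp 0 hc.hasMFDerivAt
  have h2 : h ∘ (fun t : ℝ => Circle.exp t • q) =
      fun t : ℝ => Complex.exp (t * Complex.I) * h q := by
    funext t
    rw [Function.comp_apply, heq, Circle.coe_exp]
  have h3 : HasDerivAt (fun t : ℝ => Complex.exp (t * Complex.I) * h q) (Complex.I * h q) 0 := by
    have h4 : HasDerivAt (fun t : ℝ => (t : ℂ) * Complex.I) Complex.I 0 := by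
      simpa using (Complex.ofRealCLM.hasDerivAt (x := 0)).mul_const Complex.I
    simpa using h4.cexp.mul_const (h q)
  rw [h2] at h1
  have h5 := hasMFDerivAt_unique h1 h3.hasFDerivAt.hasMFDerivAt
  have h6 := congrArg (fun L => L (1 : ℝ)) h5
  refine h6.trans ?_
  exact one_smul ℝ _
end

/-! ### The connection form -/

section
open Set
variable {n : ℕ} {M : Type*} [TopologicalSpace M] [ChartedSpace (EuclideanSpace ℝ (Fin n)) M]

/-- The one-form `(∑ Im (h̄ dh)) / ∑ |h|²` of a locally finite family of complex functions `h`
without common zero: the average of the differentials of their arguments, with weights `|h|²`. -/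
noncomputable def angularForm {ι : Type*} (h : ι → M → ℂ) (p : M) :
    TangentSpace (𝓡 n) p →ₗ[ℝ] ℝ :=
  (∑ᶠ i, Complex.normSq (h i p))⁻¹ •
    ∑ᶠ i, Complex.imLm ∘ₗ LinearMap.mulLeft ℝ ((starRingEnd ℂ) (h i p)) ∘ₗ
      (complexDifferential (h i) p).toLinearMap

theorem angularForm_apply {ι : Type*} {h : ι → M → ℂ} {p : M} {s : Finset ι}
    (hs : ∀ i ∉ s, h i p = 0) (u : TangentSpace (𝓡 n) p) :
    angularForm h p u = (∑ i ∈ s, Complex.normSq (h i p))⁻¹ *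
      ∑ i ∈ s, ((starRingEnd ℂ) (h i p) * complexDifferential (h i) p u).im := by
  rw [angularForm, finsum_eq_sum_of_support_subset (s := s),
    finsum_eq_sum_of_support_subset (s := s)]
  · simp [LinearMap.sum_apply]
  · intro i hi
    by_contra h0
    refine hi ?_
    ext u
    simp [hs i h0]
  · intro i hi
    by_contra h0
    exact hi (by simp [hs i h0])

/-- A free smooth circle action has an invariant connection form. -/
theorem exists_connection [IsManifold (𝓡 n) ∞ M] [T2Space M] [SecondCountableTopology M]
    [MulAction Circle M] [ContMDiffSMul (𝓡 1) (𝓡 n) ∞ Circle M]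
    (hfree : ∀ (z : Circle) (p : M), z • p = p → z = 1) :
    ∃ θ : ∀ p : M, TangentSpace (𝓡 n) p →ₗ[ℝ] ℝ,
      (∀ (x₀ : M) (u : EuclideanSpace ℝ (Fin n)),
        ContMDiffAt (𝓡 n) 𝓘(ℝ, ℝ) ∞ (fun x => θ x ((tangentTriv n x₀).symm x u)) x₀) ∧
      (∀ p, θ p (circleGenerator p) = 1) ∧
      ∀ (z : Circle) (p : M) (u : TangentSpace (𝓡 n) p),
        θ (z • p) (mfderiv (𝓡 n) (𝓡 n) (fun p : M => z • p) p u) = θ p u := by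
  have : LocallyCompactSpace M := ChartedSpace.locallyCompactSpace (EuclideanSpace ℝ (Fin n)) M
  choose U hUo hU hUre using exists_open_re_pos (n := n) hfree
  obtain ⟨f, hf⟩ := SmoothPartitionOfUnity.exists_isSubordinate (𝓡 n) (isClosed_univ (X := M)) U hUo
    fun p _ => mem_iUnion.mpr ⟨p, hU p⟩
  set h : M → M → ℂ := fun i => circleAverage (f i) with hdef
  have hsm : ∀ i, ContMDiff (𝓡 n) 𝓘(ℝ, ℂ) ∞ (h i) := fun i =>
    contMDiff_circleAverage (f i).contMDiff
  have heq : ∀ i (z : Circle) (q : M), h i (z • q) = (z : ℂ) * h i q := fun i =>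
    circleAverage_smul (f i)
  have hfin : ∀ p, ∃ s : Finset M, ∀ᶠ q in 𝓝 p, ∀ i ∉ s, h i q = 0 :=
    circleAverage_eventually_zero (n := n) f.locallyFinite
  have hne : ∀ p, ∃ i, h i p ≠ 0 := by
    intro p
    obtain ⟨i, hi⟩ := f.exists_pos_of_mem (mem_univ p)
    refine ⟨i, circleAverage_ne_zero (n := n) (f i).contMDiff.continuous (fun q => f.nonneg i q)
      (hUre i) (fun q hq => hf i (subset_tsupport _ hq)) hi.ne'⟩
  have hpos : ∀ p (s : Finset M), (∀ i ∉ s, h i p = 0) → 0 < ∑ i ∈ s, Complex.normSq (h i p) := by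
    intro p s hs
    obtain ⟨i, hi⟩ := hne p
    exact Finset.sum_pos' (fun _ _ => Complex.normSq_nonneg _)
      ⟨i, by_contra fun h0 => hi (hs i h0), Complex.normSq_pos.mpr hi⟩
  refine ⟨angularForm h, fun x₀ u => ?_, fun p => ?_, fun z p u => ?_⟩
  · obtain ⟨s, hs⟩ := hfin x₀
    have h1 : ContMDiffAt (𝓡 n) 𝓘(ℝ, ℝ) ∞ (fun x => ∑ i ∈ s, Complex.normSq (h i x)) x₀ := by
      refine contMDiffAt_finsetSum fun i _ => ?_
      have hns : ContDiff ℝ ∞ (fun w : ℂ => Complex.normSq w) := by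
        simp only [Complex.normSq_apply]
        exact (Complex.reCLM.contDiff.mul Complex.reCLM.contDiff).add
          (Complex.imCLM.contDiff.mul Complex.imCLM.contDiff)
      exact hns.contMDiff.contMDiffAt.comp x₀ (hsm i x₀)
    have h2 : ContMDiffAt (𝓡 n) 𝓘(ℝ, ℝ) ∞ (fun x => ∑ i ∈ s, ((starRingEnd ℂ) (h i x) *
        complexDifferential (h i) x ((tangentTriv n x₀).symm x u)).im) x₀ := by
      refine contMDiffAt_finsetSum fun i _ => ?_
      have hns : ContDiff ℝ ∞ (fun w : ℂ × ℂ => ((starRingEnd ℂ) w.1 * w.2).im) :=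
        Complex.imCLM.contDiff.comp
          ((Complex.conjCLE.contDiff.comp contDiff_fst).mul contDiff_snd)
      exact hns.contMDiff.contMDiffAt.comp x₀
        ((hsm i x₀).prodMk_space (contMDiffAt_complexDifferential (hsm i) x₀ u))
    refine ((h1.inv₀ (hpos x₀ s hs.self_of_nhds).ne').mul h2).congr_of_eventuallyEq ?_
    filter_upwards [hs] with x hx
    exact angularForm_apply hx _
  · obtain ⟨s, hs⟩ := hfin p
    rw [angularForm_apply hs.self_of_nhds]
    rw [inv_mul_eq_one₀ (hpos p s hs.self_of_nhds).ne']
    refine Finset.sum_congr rfl fun i _ => ?_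
    rw [complexDifferential_circleGenerator (hsm i) (heq i)]
    simp [Complex.normSq_apply]
  · obtain ⟨s, hs⟩ := hfin p
    have hs' : ∀ i ∉ s, h i (z • p) = 0 := fun i hi => by
      rw [heq, hs.self_of_nhds i hi, mul_zero]
    rw [angularForm_apply hs.self_of_nhds, angularForm_apply hs']
    have hz : Complex.normSq (z : ℂ) = 1 := Circle.normSq_coe z
    congr 2
    · refine Finset.sum_congr rfl fun i _ => ?_
      rw [heq, Complex.normSq_mul, hz, one_mul]
    · funext i
      rw [complexDifferential_smul (hsm i) (heq i), heq, map_mul]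
      have : (starRingEnd ℂ) (z : ℂ) * z = 1 := by
        rw [mul_comm, Complex.mul_conj, hz, Complex.ofReal_one]
      congr 1
      linear_combination ((starRingEnd ℂ) (h i p) * complexDifferential (h i) p u) * this
end

/-! ### Splitting a vector space along a functional -/

section
variable {V W : Type*} [AddCommGroup V] [Module ℝ V] [AddCommGroup W] [Module ℝ W]

/-- The splitting `ℝ⁸ = ℝ ⊕ ℝ⁷`. -/
noncomputable def headTail :
    EuclideanSpace ℝ (Fin 8) ≃ₗ[ℝ] ℝ × EuclideanSpace ℝ (Fin 7) where
  toLinearMap := headProj.prod tailProj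
  invFun w := WithLp.toLp 2 (Fin.cons w.1 w.2)
  left_inv w := by
    ext i
    refine Fin.cases rfl (fun i => rfl) i
  right_inv w := by
    refine Prod.ext rfl ?_
    ext i
    rfl

theorem headTail_symm_zero (w : ℝ × EuclideanSpace ℝ (Fin 7)) : headTail.symm w 0 = w.1 := rfl

theorem headTail_symm_succ (w : ℝ × EuclideanSpace ℝ (Fin 7)) (i : Fin 7) :
    headTail.symm w i.succ = w.2 i := rfl

theorem inner_headTail_symm (a b : ℝ) (x y : EuclideanSpace ℝ (Fin 7)) :
    (inner ℝ (headTail.symm (a, x)) (headTail.symm (b, y)) : ℝ) = a * b + inner ℝ x y := by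
  simp only [PiLp.inner_apply]
  rw [Fin.sum_univ_succ]
  simp only [headTail_symm_zero, headTail_symm_succ]
  simp [mul_comm]

variable [FiniteDimensional ℝ V] (hV : Module.finrank ℝ V = 8)
  (θ : V →ₗ[ℝ] ℝ) (d : V →ₗ[ℝ] W) (hd : Function.Surjective d)
  (v : V) (hdv : d v = 0) (hθv : θ v = 1) (f : EuclideanSpace ℝ (Fin 7) ≃ₗ[ℝ] W)

/-- The linear map `w ↦ (θ w, f⁻¹ (d w))` from `V` to `ℝ ⊕ ℝ⁷ = ℝ⁸`. -/
noncomputable def splitMap : V →ₗ[ℝ] EuclideanSpace ℝ (Fin 8) :=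
  headTail.symm.toLinearMap ∘ₗ θ.prod (f.symm.toLinearMap ∘ₗ d)

include hd hdv hθv hV in
theorem bijective_splitMap : Function.Bijective (splitMap θ d f) := by
  have hs : Function.Surjective (splitMap θ d f) := by
    refine headTail.symm.surjective.comp fun w => ?_
    obtain ⟨u, hu⟩ := hd (f w.2)
    refine ⟨u + (w.1 - θ u) • v, Prod.ext ?_ ?_⟩
    · simp [hθv]
    · simp [hdv, hu]
  exact ⟨(LinearMap.injective_iff_surjective_of_finrank_eq_finrank (by simp [hV])).mpr hs, hs⟩

/-- A vector space `V` with a functional `θ` and a surjection `d` onto `W` whose kernel is spanned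
by a vector `v` with `θ v = 1` is `ℝ ⊕ ℝ⁷`, once a frame `f` of `W` has been chosen. -/
noncomputable def splitEquiv : EuclideanSpace ℝ (Fin 8) ≃ₗ[ℝ] V :=
  (LinearEquiv.ofBijective (splitMap θ d f) (bijective_splitMap hV θ d hd v hdv hθv f)).symm

theorem inner_splitEquiv_symm (u w : V) :
    (inner ℝ ((splitEquiv hV θ d hd v hdv hθv f).symm u)
      ((splitEquiv hV θ d hd v hdv hθv f).symm w) : ℝ) =
      θ u * θ w + inner ℝ (f.symm (d u)) (f.symm (d w)) :=
  inner_headTail_symm _ _ _ _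

theorem comp_splitEquiv_headProj :
    θ ∘ₗ (splitEquiv hV θ d hd v hdv hθv f : EuclideanSpace ℝ (Fin 8) →ₗ[ℝ] V) = headProj := by
  ext w
  exact congrArg headProj ((splitEquiv hV θ d hd v hdv hθv f).symm_apply_apply w)

theorem comp_splitEquiv_tailProj :
    d ∘ₗ (splitEquiv hV θ d hd v hdv hθv f : EuclideanSpace ℝ (Fin 8) →ₗ[ℝ] V) =
      (f : EuclideanSpace ℝ (Fin 7) →ₗ[ℝ] W) ∘ₗ tailProj := by
  refine LinearMap.ext fun w => f.symm.injective ?_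
  exact (congrArg tailProj ((splitEquiv hV θ d hd v hdv hθv f).symm_apply_apply w)).trans
    (f.symm_apply_apply _).symm
end

section
theorem det_symm_mul_det {n : ℕ}
    (A : EuclideanSpace ℝ (Fin n) ≃ₗ[ℝ] EuclideanSpace ℝ (Fin n)) :
    LinearMap.det (A.symm : EuclideanSpace ℝ (Fin n) →ₗ[ℝ] EuclideanSpace ℝ (Fin n)) *
      LinearMap.det (A : EuclideanSpace ℝ (Fin n) →ₗ[ℝ] EuclideanSpace ℝ (Fin n)) = 1 := by
  rw [← LinearMap.det_comp]
  simp

/-- Stated in terms of the inverses since for the frames constructed from a connection form it is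
the inverse which has a simple matrix. -/
theorem orientation_map_stdOrientation_eq_iff {n : ℕ}
    (A B : EuclideanSpace ℝ (Fin n) ≃ₗ[ℝ] EuclideanSpace ℝ (Fin n)) :
    Orientation.map (Fin n) A (stdOrientation n) = Orientation.map (Fin n) B (stdOrientation n) ↔
      0 < LinearMap.det (A.symm : EuclideanSpace ℝ (Fin n) →ₗ[ℝ] EuclideanSpace ℝ (Fin n)) *
        LinearMap.det (B.symm : EuclideanSpace ℝ (Fin n) →ₗ[ℝ] EuclideanSpace ℝ (Fin n)) := by
  have h1 : Orientation.map (Fin n) A (stdOrientation n) =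
      Orientation.map (Fin n) B (stdOrientation n) ↔
      Orientation.map (Fin n) (A.trans B.symm) (stdOrientation n) = stdOrientation n := by
    have h2 : Orientation.map (Fin n) (A.trans B.symm) (stdOrientation n) =
        (Orientation.map (Fin n) B).symm (Orientation.map (Fin n) A (stdOrientation n)) := by
      induction stdOrientation n using Module.Ray.ind with
      | h g hg => rfl
    rw [h2, Equiv.symm_apply_eq]
  rw [h1, Orientation.map_eq_iff_det_pos _ _ (by simp)]
  rw [LinearEquiv.coe_trans, LinearMap.det_comp]
  have hA := det_symm_mul_det A
  set a := LinearMap.det (A : EuclideanSpace ℝ (Fin n) →ₗ[ℝ] EuclideanSpace ℝ (Fin n))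
  set a' := LinearMap.det (A.symm : EuclideanSpace ℝ (Fin n) →ₗ[ℝ] EuclideanSpace ℝ (Fin n))
  set b' := LinearMap.det (B.symm : EuclideanSpace ℝ (Fin n) →ₗ[ℝ] EuclideanSpace ℝ (Fin n))
  have ha : 0 < a ^ 2 := by
    have : a ≠ 0 := right_ne_zero_of_mul_eq_one hA
    positivity
  have ha' : 0 < a' ^ 2 := by
    have : a' ≠ 0 := left_ne_zero_of_mul_eq_one hA
    positivity
  constructor <;> intro h
  · have h3 : a' * b' = a' ^ 2 * (b' * a) := by linear_combination (-(a' * b')) * hA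
    rw [h3]; positivity
  · have h3 : b' * a = a ^ 2 * (a' * b') := by linear_combination (-(a * b')) * hA
    rw [h3]; positivity

theorem det_headTail_prodMap
    (R : EuclideanSpace ℝ (Fin 7) →ₗ[ℝ] EuclideanSpace ℝ (Fin 7)) :
    LinearMap.det (headTail.symm.toLinearMap ∘ₗ (LinearMap.id.prodMap R) ∘ₗ headTail.toLinearMap)
      = LinearMap.det R := by
  have h := LinearMap.det_conj
    ((LinearMap.id : ℝ →ₗ[ℝ] ℝ).prodMap R) headTail.symm
  refine h.trans ?_
  rw [LinearMap.det_prodMap, LinearMap.det_id, one_mul]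

theorem orientation_map_trans {V W : Type*} [AddCommGroup V] [Module ℝ V] [AddCommGroup W]
    [Module ℝ W] {n : ℕ} (A : EuclideanSpace ℝ (Fin n) ≃ₗ[ℝ] V) (B : V ≃ₗ[ℝ] W)
    (o : Orientation ℝ (EuclideanSpace ℝ (Fin n)) (Fin n)) :
    Orientation.map (Fin n) B (Orientation.map (Fin n) A o) =
      Orientation.map (Fin n) (A.trans B) o := by
  induction o using Module.Ray.ind with
  | h g hg => rfl
end

/-! ### Frames, orientation and four-form of the total space -/

section
variable {M N : Type*} [TopologicalSpace M] [ChartedSpace (EuclideanSpace ℝ (Fin 8)) M]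
  [TopologicalSpace N] [ChartedSpace (EuclideanSpace ℝ (Fin 7)) N] {π : M → N}
  (hπ : IsSmoothSubmersion 8 7 π)
  {θ : ∀ p : M, TangentSpace (𝓡 8) p →ₗ[ℝ] ℝ} {v : ∀ p : M, TangentSpace (𝓡 8) p}
  (hv : ∀ p, mfderiv (𝓡 8) (𝓡 7) π p (v p) = 0) (hθv : ∀ p, θ p (v p) = 1)
  (f : ∀ x : N, EuclideanSpace ℝ (Fin 7) ≃ₗ[ℝ] TangentSpace (𝓡 7) x)

/-- The frame of `T_pM` given by a connection form `θ`, the vertical field `v` and a frame of the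
tangent space of the base. -/
noncomputable def connectionFrame (p : M) :
    EuclideanSpace ℝ (Fin 8) ≃ₗ[ℝ] TangentSpace (𝓡 8) p :=
  splitEquiv (finrank_euclideanSpace_fin (𝕜 := ℝ) (n := 8)) (θ p)
    (mfderiv (𝓡 8) (𝓡 7) π p).toLinearMap (hπ.2 p) (v p) (hv p) (hθv p) (f (π p))

theorem pullbackForm_compLinearMap_connectionFrame {k : ℕ} (α : FormField 7 k N) (p : M) :
    (pullbackForm π α p).compLinearMap (connectionFrame hπ hv hθv f p).toLinearMap =
      ((α (π p)).compLinearMap (f (π p)).toLinearMap).compLinearMap tailProj := by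
  ext w
  exact congrArg (α (π p)) (funext fun i => LinearMap.congr_fun (comp_splitEquiv_tailProj
    (finrank_euclideanSpace_fin (𝕜 := ℝ) (n := 8)) (θ p) (mfderiv (𝓡 8) (𝓡 7) π p).toLinearMap
    (hπ.2 p) (v p) (hv p) (hθv p) (f (π p))) (w i))

/-- The form `χ` on the base whose components in the frames `f` are those of `chiZero`: for
`G₂`-frames this is the Hodge dual of the three-form. -/
noncomputable def dualForm : FormField 7 4 N :=
  fun x => chiZero.compLinearMap (f x).symm.toLinearMap

variable {f}

theorem dualForm_compLinearMap_connectionFrame (p : M) :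
    (pullbackForm π (dualForm f) p).compLinearMap (connectionFrame hπ hv hθv f p).toLinearMap =
      chiZero.compLinearMap tailProj := by
  rw [pullbackForm_compLinearMap_connectionFrame]
  ext w
  exact congrArg chiZero (funext fun i => (f (π p)).symm_apply_apply _)

theorem wedgeForm_compLinearMap_connectionFrame {ψ : FormField 7 3 N}
    (hf : ∀ x, (ψ x).compLinearMap (f x).toLinearMap = phiZero) (p : M) :
    (wedgeForm (oneForm (θ p)) (pullbackForm π ψ p)).compLinearMap
      (connectionFrame hπ hv hθv f p).toLinearMap =
      wedgeForm (oneForm headProj) (phiZero.compLinearMap tailProj) := by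
  rw [wedgeForm_oneForm_compLinearMap, pullbackForm_compLinearMap_connectionFrame, hf]
  congr 2
  exact comp_splitEquiv_headProj _ _ _ _ _ _ _ _

/-- The form `θ ∧ π^*ψ + π^*χ`. -/
noncomputable def connectionFourForm (θ : ∀ p : M, TangentSpace (𝓡 8) p →ₗ[ℝ] ℝ) (π : M → N)
    (ψ : FormField 7 3 N) (χ : FormField 7 4 N) : FormField 8 4 M :=
  fun p => wedgeForm (oneForm (θ p)) (pullbackForm π ψ p) + pullbackForm (k := 1 + 3) π χ p

theorem connectionFourForm_compLinearMap_connectionFrame {ψ : FormField 7 3 N}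
    (hf : ∀ x, (ψ x).compLinearMap (f x).toLinearMap = phiZero) (p : M) :
    (connectionFourForm θ π ψ (dualForm f) p).compLinearMap
      (connectionFrame hπ hv hθv f p).toLinearMap = omegaZero := by
  refine (AlternatingMap.add_compLinearMap _ _ _).trans (Eq.trans ?_ omegaZero_eq.symm)
  exact congrArg₂ (· + ·) (wedgeForm_compLinearMap_connectionFrame hπ hv hθv hf p)
    (dualForm_compLinearMap_connectionFrame hπ hv hθv p)

/-- Invariance of `θ` and of `π` under a map implies that of `θ ∧ π^*ψ + π^*χ`. -/
theorem pullbackForm_connectionFourForm {F : M → M} (hF : ContMDiff (𝓡 8) (𝓡 8) ∞ F)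
    (hπ : ContMDiff (𝓡 8) (𝓡 7) ∞ π) (hFπ : π ∘ F = π)
    (hFθ : ∀ p u, θ (F p) (mfderiv (𝓡 8) (𝓡 8) F p u) = θ p u)
    (ψ : FormField 7 3 N) (χ : FormField 7 4 N) :
    pullbackForm F (connectionFourForm θ π ψ χ) = connectionFourForm θ π ψ χ := by
  have hpull : ∀ {k : ℕ} (α : FormField 7 k N) (p : M),
      (pullbackForm π α (F p)).compLinearMap (mfderiv (𝓡 8) (𝓡 8) F p).toLinearMap =
        pullbackForm π α p := by
    intro k α p
    have h : pullbackForm (m := 8) (π ∘ F) α p = pullbackForm π α p := by rw [hFπ]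
    rw [← h]
    ext u
    refine congrArg (α (π (F p))) (funext fun i => ?_)
    have h2 := mfderiv_comp p ((hπ (F p)).mdifferentiableAt (by simp))
      ((hF p).mdifferentiableAt (by simp))
    exact (congrArg (fun L => L (u i)) h2).symm
  funext p
  have h1 : (wedgeForm (oneForm (θ (F p))) (pullbackForm π ψ (F p))).compLinearMap
      (mfderiv (𝓡 8) (𝓡 8) F p).toLinearMap = wedgeForm (oneForm (θ p)) (pullbackForm π ψ p) := by
    rw [wedgeForm_oneForm_compLinearMap, hpull]
    congr 2
    exact LinearMap.ext fun u => hFθ p u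
  change (wedgeForm (oneForm (θ (F p))) (pullbackForm π ψ (F p))).compLinearMap
      (mfderiv (𝓡 8) (𝓡 8) F p).toLinearMap + (pullbackForm π χ (F p)).compLinearMap
      (mfderiv (𝓡 8) (𝓡 8) F p).toLinearMap = _
  rw [h1, hpull]
  rfl
/-- `π^*χ` is the Hodge dual of `θ ∧ π^*ψ`, with the frame at hand as oriented orthonormal basis. -/
theorem isHodgeStar_pullbackForm_dualForm {ψ : FormField 7 3 N}
    (hf : ∀ x, (ψ x).compLinearMap (f x).toLinearMap = phiZero) (p : M)
    {g : TangentSpace (𝓡 8) p → TangentSpace (𝓡 8) p → ℝ}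
    (hg : ∀ u w, g u w = inner ℝ ((connectionFrame hπ hv hθv f p).symm u)
      ((connectionFrame hπ hv hθv f p).symm w)) :
    IsHodgeStar (k := 4) (l := 4) g
      (Orientation.map (Fin 8) (connectionFrame hπ hv hθv f p) (stdOrientation 8))
      (wedgeForm (oneForm (θ p)) (pullbackForm π ψ p)) (pullbackForm π (dualForm f) p) := by
  set F := connectionFrame hπ hv hθv f p with hF
  refine ⟨(EuclideanSpace.basisFun (Fin 8) ℝ).toBasis.map F, ?_, fun i j => ?_, fun σ => ?_⟩
  · exact Module.Basis.orientation_map _ _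
  · rw [hg]
    simp only [Module.Basis.map_apply, LinearEquiv.symm_apply_apply,
      OrthonormalBasis.coe_toBasis]
    exact orthonormal_iff_ite.mp (EuclideanSpace.basisFun (Fin 8) ℝ).orthonormal i j
  · have h1 := dualForm_compLinearMap_connectionFrame hπ hv hθv (f := f) p
    have h2 := wedgeForm_compLinearMap_connectionFrame hπ hv hθv hf p
    have h3 := chiZero_star σ
    rw [← h1, ← h2] at h3
    simp only [Module.Basis.map_apply, OrthonormalBasis.coe_toBasis]
    exact h3
variable [IsManifold (𝓡 8) ∞ M] [IsManifold (𝓡 7) ∞ N]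

theorem isSmoothForm_connectionFourForm (hπ : ContMDiff (𝓡 8) (𝓡 7) ∞ π)
    (hθ : ∀ (x₀ : M) (u : EuclideanSpace ℝ (Fin 8)),
      ContMDiffAt (𝓡 8) 𝓘(ℝ, ℝ) ∞ (fun x => θ x ((tangentTriv 8 x₀).symm x u)) x₀)
    {ψ : FormField 7 3 N} (hψ : IsSmoothForm ψ) {χ : FormField 7 4 N} (hχ : IsSmoothForm χ) :
    IsSmoothForm (connectionFourForm θ π ψ χ) := by
  intro x₀ w
  have hm : ∀ a b c d, ContMDiffAt (𝓡 8) 𝓘(ℝ, ℝ) ∞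
      (fun x => θ x ((tangentTriv 8 x₀).symm x a) * pullbackForm (m := 8) π ψ x
        ![(tangentTriv 8 x₀).symm x b, (tangentTriv 8 x₀).symm x c,
          (tangentTriv 8 x₀).symm x d]) x₀ := by
    intro a b c d
    have h := hψ.pullbackForm hπ x₀ ![b, c, d]
    simp only [comp_vecCons_three] at h
    exact (hθ x₀ a).mul h
  have heq : ∀ x, connectionFourForm θ π ψ χ x (fun i => (tangentTriv 8 x₀).symm x (w i)) =
      θ x ((tangentTriv 8 x₀).symm x (w 0)) * pullbackForm (m := 8) π ψ x
        ![(tangentTriv 8 x₀).symm x (w 1), (tangentTriv 8 x₀).symm x (w 2),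
          (tangentTriv 8 x₀).symm x (w 3)] -
      θ x ((tangentTriv 8 x₀).symm x (w 1)) * pullbackForm (m := 8) π ψ x
        ![(tangentTriv 8 x₀).symm x (w 0), (tangentTriv 8 x₀).symm x (w 2),
          (tangentTriv 8 x₀).symm x (w 3)] -
      θ x ((tangentTriv 8 x₀).symm x (w 2)) * pullbackForm (m := 8) π ψ x
        ![(tangentTriv 8 x₀).symm x (w 1), (tangentTriv 8 x₀).symm x (w 0),
          (tangentTriv 8 x₀).symm x (w 3)] -
      θ x ((tangentTriv 8 x₀).symm x (w 3)) * pullbackForm (m := 8) π ψ x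
        ![(tangentTriv 8 x₀).symm x (w 1), (tangentTriv 8 x₀).symm x (w 2),
          (tangentTriv 8 x₀).symm x (w 0)] +
      pullbackForm (m := 8) π χ x (fun i => (tangentTriv 8 x₀).symm x (w i)) := fun x =>
    congrArg (· + _) (wedgeForm_oneForm_apply (θ x) (pullbackForm (m := 8) π ψ x)
      (fun i => (tangentTriv 8 x₀).symm x (w i)))
  simp only [heq]
  exact ((((hm _ _ _ _).sub (hm _ _ _ _)).sub (hm _ _ _ _)).sub (hm _ _ _ _)).add
    (hχ.pullbackForm hπ x₀ w)

variable (f)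

/-- The matrix of `(θ, dπ)` in the coordinates of charts around `x₀` and `π x₀`. -/
noncomputable def splitMatrix (π : M → N) (θ : ∀ p : M, TangentSpace (𝓡 8) p →ₗ[ℝ] ℝ) (x₀ x : M) :
    Matrix (Fin 8) (Fin 8) ℝ :=
  Matrix.of fun i j => headTail.symm
    (θ x ((tangentTriv 8 x₀).symm x (EuclideanSpace.basisFun (Fin 8) ℝ j)),
      mfderivCoord 7 π x₀ x (EuclideanSpace.basisFun (Fin 8) ℝ j)) i

/-- In coordinates, the inverse of `connectionFrame` is `splitMatrix`, which is continuous, followed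
by `1 ⊕ f⁻¹`, whose sign is locally constant since the base is oriented. -/
theorem det_connectionFrame_symm (x₀ x : M) (hx : x ∈ (tangentTriv 8 x₀).baseSet)
    (hy : π x ∈ (tangentTriv 7 (π x₀)).baseSet) :
    LinearMap.det (((connectionFrame hπ hv hθv f x).trans
        ((tangentTriv 8 x₀).linearEquivAt ℝ x hx)).symm :
        EuclideanSpace ℝ (Fin 8) →ₗ[ℝ] EuclideanSpace ℝ (Fin 8)) =
      LinearMap.det (((f (π x)).trans ((tangentTriv 7 (π x₀)).linearEquivAt ℝ (π x) hy)).symm :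
        EuclideanSpace ℝ (Fin 7) →ₗ[ℝ] EuclideanSpace ℝ (Fin 7)) *
      (splitMatrix π θ x₀ x).det := by
  set t := (tangentTriv 8 x₀).linearEquivAt ℝ x hx
  set s := (tangentTriv 7 (π x₀)).linearEquivAt ℝ (π x) hy
  set B : EuclideanSpace ℝ (Fin 8) →ₗ[ℝ] EuclideanSpace ℝ (Fin 8) :=
    headTail.symm.toLinearMap ∘ₗ (θ x ∘ₗ t.symm.toLinearMap).prod
      (s.toLinearMap ∘ₗ (mfderiv (𝓡 8) (𝓡 7) π x).toLinearMap ∘ₗ t.symm.toLinearMap)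
  have hB : LinearMap.det B = (splitMatrix π θ x₀ x).det := by
    rw [← LinearMap.det_toMatrix (EuclideanSpace.basisFun (Fin 8) ℝ).toBasis]
    congr 1
    ext i j
    rw [LinearMap.toMatrix_apply, OrthonormalBasis.coe_toBasis]
    have h : s (mfderiv (𝓡 8) (𝓡 7) π x ((tangentTriv 8 x₀).symm x
        (EuclideanSpace.basisFun (Fin 8) ℝ j))) =
        mfderivCoord 7 π x₀ x (EuclideanSpace.basisFun (Fin 8) ℝ j) := by
      rw [mfderiv_tangentTriv_symm hx hy]
      exact s.apply_symm_apply _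
    exact congrArg (fun w => headTail.symm
      (θ x ((tangentTriv 8 x₀).symm x (EuclideanSpace.basisFun (Fin 8) ℝ j)), w) i) h
  rw [← hB, ← det_headTail_prodMap, ← LinearMap.det_comp]
  congr 1
  ext1 u
  change headTail.symm (_, _) = headTail.symm (_, _)
  refine congrArg headTail.symm (Prod.ext rfl ?_)
  change (f (π x)).symm _ = (f (π x)).symm (s.symm (s _))
  rw [s.symm_apply_apply]
  rfl

theorem continuousAt_det_splitMatrix (hπ : ContMDiff (𝓡 8) (𝓡 7) ∞ π)
    (hθ : ∀ (x₀ : M) (u : EuclideanSpace ℝ (Fin 8)),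
      ContMDiffAt (𝓡 8) 𝓘(ℝ, ℝ) ∞ (fun x => θ x ((tangentTriv 8 x₀).symm x u)) x₀) (x₀ : M) :
    ContinuousAt (fun x => (splitMatrix π θ x₀ x).det) x₀ := by
  have hdet : Continuous fun A : Matrix (Fin 8) (Fin 8) ℝ => A.det := continuous_id.matrix_det
  have h : ContinuousAt (splitMatrix π θ x₀) x₀ := by
    refine continuousAt_pi.mpr fun i => continuousAt_pi.mpr fun j => ?_
    refine Fin.cases ?_ (fun i => ?_) i
    · exact (hθ x₀ _).continuousAt
    · exact (contMDiffAt_mfderivCoord_apply hπ x₀ _ i).continuousAt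
  exact hdet.continuousAt.comp h

/-- The orientations of the tangent spaces of `M` defined by the frames are locally constant. -/
theorem eventually_orientation_connectionFrame
    (hθ : ∀ (x₀ : M) (u : EuclideanSpace ℝ (Fin 8)),
      ContMDiffAt (𝓡 8) 𝓘(ℝ, ℝ) ∞ (fun x => θ x ((tangentTriv 8 x₀).symm x u)) x₀)
    (o : ManifoldOrientation 7 N)
    (hf : ∀ x, Orientation.map (Fin 7) (f x) (stdOrientation 7) = o.at' x) (x₀ : M) :
    ∀ᶠ x in 𝓝 x₀, ∃ hx : x ∈ (tangentTriv 8 x₀).baseSet,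
      Orientation.map (Fin 8) ((tangentTriv 8 x₀).linearEquivAt ℝ x hx)
          (Orientation.map (Fin 8) (connectionFrame hπ hv hθv f x) (stdOrientation 8)) =
        Orientation.map (Fin 8) ((tangentTriv 8 x₀).linearEquivAt ℝ x₀
          (FiberBundle.mem_baseSet_trivializationAt' x₀))
          (Orientation.map (Fin 8) (connectionFrame hπ hv hθv f x₀) (stdOrientation 8)) := by
  have hdet₀ := det_connectionFrame_symm hπ hv hθv f x₀ x₀
    (FiberBundle.mem_baseSet_trivializationAt' x₀)
    (FiberBundle.mem_baseSet_trivializationAt' (π x₀))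
  have hne : (splitMatrix π θ x₀ x₀).det ≠ 0 := fun h0 =>
    (LinearEquiv.isUnit_det' _).ne_zero (hdet₀.trans (by rw [h0, mul_zero]))
  have hcont := continuousAt_det_splitMatrix hπ.1 hθ x₀
  have hpos : ∀ᶠ x in 𝓝 x₀, 0 < (splitMatrix π θ x₀ x).det * (splitMatrix π θ x₀ x₀).det :=
    (hcont.mul continuousAt_const).eventually (lt_mem_nhds (mul_self_pos.mpr hne))
  filter_upwards [eventually_mem_baseSet (m := 8) x₀, hpos,
    hπ.1.continuous.continuousAt.eventually (o.locallyConstant (π x₀))] with x hx hdet ⟨hy, ho⟩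
  refine ⟨hx, ?_⟩
  rw [← hf, ← hf, orientation_map_trans, orientation_map_trans,
    orientation_map_stdOrientation_eq_iff] at ho
  rw [orientation_map_trans, orientation_map_trans, orientation_map_stdOrientation_eq_iff,
    hdet₀, det_connectionFrame_symm hπ hv hθv f x₀ x hx hy]
  have h := mul_pos ho hdet
  refine h.trans_eq ?_
  ring
end

section
variable {M : Type*} [MulAction Circle M]

theorem circleQuotientMap_smul (z : Circle) (p : M) :
    circleQuotientMap M (z • p) = circleQuotientMap M p :=
  Quotient.sound ⟨z, rfl⟩

variable [TopologicalSpace M] [ChartedSpace (EuclideanSpace ℝ (Fin 8)) M]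
  [ContMDiffSMul (𝓡 1) (𝓡 8) ∞ Circle M]
  [ChartedSpace (EuclideanSpace ℝ (Fin 7)) (MulAction.orbitRel.Quotient Circle M)]

theorem mfderiv_circleQuotientMap_circleGenerator
    (hquot : IsSmoothSubmersion 8 7 (circleQuotientMap M)) (p : M) :
    mfderiv (𝓡 8) (𝓡 7) (circleQuotientMap M) p (circleGenerator p) = 0 := by
  have hc := mdifferentiableAt_exp_smul (n := 8) p
  have hq : ∀ q : M, q = p → HasMFDerivAt (𝓡 8) (𝓡 7) (circleQuotientMap M) q
      (mfderiv (𝓡 8) (𝓡 7) (circleQuotientMap M) p :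
        EuclideanSpace ℝ (Fin 8) →L[ℝ] EuclideanSpace ℝ (Fin 7)) := by
    rintro _ rfl
    exact (hquot.1.mdifferentiable (by simp) _).hasMFDerivAt
  have h1 := (hq (Circle.exp 0 • p) (by simp)).comp 0 hc.hasMFDerivAt
  have h2 : circleQuotientMap M ∘ (fun t : ℝ => Circle.exp t • p) =
      fun _ => circleQuotientMap M p := funext fun t => circleQuotientMap_smul _ p
  rw [h2] at h1
  exact congrArg (fun L => L (1 : ℝ)) (hasMFDerivAt_unique h1 (hasMFDerivAt_const _ _))
end

theorem mainTheorem4 {M : Type*} [TopologicalSpace M] [T2Space M] [SecondCountableTopology M]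
    [ChartedSpace (EuclideanSpace ℝ (Fin 8)) M] [IsManifold (𝓡 8) ∞ M]
    [MulAction Circle M] [ContMDiffSMul (𝓡 1) (𝓡 8) ∞ Circle M]
    (hfree : ∀ (z : Circle) (p : M), z • p = p → z = 1)
    [ChartedSpace (EuclideanSpace ℝ (Fin 7)) (MulAction.orbitRel.Quotient Circle M)]
    [IsManifold (𝓡 7) ∞ (MulAction.orbitRel.Quotient Circle M)]
    (hquot : IsSmoothSubmersion 8 7 (circleQuotientMap M))
    (S : G2Structure (MulAction.orbitRel.Quotient Circle M)) :
    ∃ (gN : SmoothMetric 7 (MulAction.orbitRel.Quotient Circle M))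
      (T : Spin7Structure M) (gM : SmoothMetric 8 M),
      S.Induces gN ∧ T.Induces gM ∧
      IsRiemannianSubmersion gM gN (circleQuotientMap M) ∧
      (∀ p : M, gM.innerAt p (circleGenerator p) (circleGenerator p) = 1) ∧
      (∀ p : M, ∃ γ : TangentSpace (𝓡 8) p [⋀^Fin 4]→ₗ[ℝ] ℝ,
        IsHodgeStar (k := 4) (l := 4) (gM.innerAt p) (T.orientation.at' p)
          (wedgeForm (flatForm gM circleGenerator p)
            (pullbackForm (circleQuotientMap M) S.form p)) γ ∧
        T.form p =
          wedgeForm (flatForm gM circleGenerator p)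
            (pullbackForm (circleQuotientMap M) S.form p) + γ) ∧
      (∀ z : Circle, pullbackForm (fun p : M => z • p) T.form = T.form) := by
  -- The frames `f` are chosen pointwise and may be discontinuous in the base point.
  choose f hf using S.positive
  obtain ⟨gN, hgN, hgN'⟩ := G2Structure.exists_induces hf
  obtain ⟨θ, hθ, hθv, hθinv⟩ := exists_connection (n := 8) hfree
  have hv := mfderiv_circleQuotientMap_circleGenerator hquot
  set π := circleQuotientMap M
  set F := connectionFrame hquot hv hθv f with hF
  have hinner : ∀ p u w, (inner ℝ ((F p).symm u) ((F p).symm w) : ℝ) =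
      θ p u * θ p w + gN.innerAt (π p) (mfderiv (𝓡 8) (𝓡 7) π p u)
        (mfderiv (𝓡 8) (𝓡 7) π p w) := by
    intro p u w
    rw [hgN']
    exact inner_splitEquiv_symm _ _ _ _ _ _ _ _ u w
  have hsmooth : ∀ (x₀ : M) (u w : EuclideanSpace ℝ (Fin 8)), ContMDiffAt (𝓡 8) 𝓘(ℝ, ℝ) ∞
      (fun x => (inner ℝ ((F x).symm ((tangentTriv 8 x₀).symm x u))
        ((F x).symm ((tangentTriv 8 x₀).symm x w)) : ℝ)) x₀ := by
    intro x₀ u w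
    simp only [hinner]
    exact ((hθ x₀ u).mul (hθ x₀ w)).add (gN.contMDiffAt_innerAt_mfderiv hquot.1 x₀ u w)
  let gM : SmoothMetric 8 M := SmoothMetric.ofFrames F hsmooth
  have hgM : ∀ p u w, gM.innerAt p u w = θ p u * θ p w +
      gN.innerAt (π p) (mfderiv (𝓡 8) (𝓡 7) π p u) (mfderiv (𝓡 8) (𝓡 7) π p w) := hinner
  have hvert : ∀ p u, gM.innerAt p (circleGenerator p) u = θ p u := by
    intro p u
    rw [hgM, hθv, hv, one_mul]
    simp [SmoothMetric.innerAt]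
  have hflat : ∀ p, flatForm gM circleGenerator p = oneForm (θ p) := fun p =>
    congrArg oneForm (LinearMap.ext (hvert p))
  have hform : ∀ x, (S.form x).compLinearMap (f x).toLinearMap = phiZero := fun x => (hf x).2
  let T : Spin7Structure M :=
    { orientation :=
        { at' := fun p => Orientation.map (Fin 8) (F p) (stdOrientation 8)
          locallyConstant := eventually_orientation_connectionFrame hquot hv hθv f hθ
            S.orientation fun x => (hf x).1 }
      form := connectionFourForm θ π S.form (dualForm f)
      smooth := isSmoothForm_connectionFourForm hquot.1 hθ S.smooth
        (G2Structure.isSmoothForm_chi hf)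
      admissible := fun p => ⟨F p, rfl,
        connectionFourForm_compLinearMap_connectionFrame hquot hv hθv hform p⟩ }
  refine ⟨gN, T, gM, hgN, fun p => ⟨F p, ⟨rfl,
    connectionFourForm_compLinearMap_connectionFrame hquot hv hθv hform p⟩, fun u w => ?_⟩,
    ⟨hquot, fun p u w hu hw => ?_⟩, fun p => ?_, fun p => ⟨pullbackForm π (dualForm f) p, ?_, ?_⟩,
    fun z => ?_⟩
  · change inner ℝ ((F p).symm (F p u)) ((F p).symm (F p w)) = _
    rw [LinearEquiv.symm_apply_apply, LinearEquiv.symm_apply_apply]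
  · have h1 := hu _ (hv p)
    rw [hvert] at h1
    rw [hgM, h1, zero_mul, zero_add]
  · rw [hvert, hθv]
  · rw [hflat]
    exact isHodgeStar_pullbackForm_dualForm hquot hv hθv hform p fun _ _ => rfl
  · rw [hflat]
    rfl
  · exact pullbackForm_connectionFourForm (contMDiff_circle_smul z) hquot.1
      (funext fun p => circleQuotientMap_smul z p) (fun p u => hθinv z p u) _ _
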